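/- Let $(Z_t)_{t\ge 0}$ be the discrete-time lazy random walk on $\mathbb Z_+=\{0,1,2,\dots\}$ started at $Z_0=0$, with transition probabilities $p(x,x+1)=1/3$ and $p(x+1,x)=1/6$ for all $x\in\mathbb Z_+$ (so $p(x,x)=1/2$ for $x\ge 1$ and $p(0,0)=2/3$), all other transition probabilities being $0$. For $N\ge 1$ let $\mathcal T_N:=\inf\{t\ge 0: Z_t=N\}$. Define $\varphi:\mathbb R\to(0,\infty]$ by $$\varphi(\lambda)=\begin{cases}\infty & \text{if }\lambda>\log\frac{6}{3+2\sqrt2},\\[2pt] \dfrac{6e^{-\lambda}-3}{2}-\dfrac{\sqrt{(6e^{-\lambda}-3)^2-8}}{2} & \text{if }\lambda\le\log\frac{6}{3+2\sqrt2},\end{cases}$$ and let $\Psi(s):=\sup_{\lambda\in\mathbb R}\,[\lambda s-\log\varphi(\lambda)]$. Then $\Psi(s)$ is finite for every $s\ge 1$; for all $N\ge1$ and $s\ge1$ the probabilities $\mathbb P[\mathcal T_N=\lfloor sN\rfloor]$, $\mathbb P[\mathcal T_N\le sN]$ and $\mathbb P[\mathcal T_N\ge sN]$ are positive; and $$\lim_{N\to\infty}\frac1N\log\mathbb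 P[\mathcal T_N=\lfloor sN\rfloor]=\lim_{N\to\infty}\frac1N\log\mathbb P[\mathcal T_N\le sN]=-\Psi(s)\qquad\text{for } s\in[1,6],$$ $$\lim_{N\to\infty}\frac1N\log\mathbb P[\mathcal T_N=\lfloor sN\rfloor]=\lim_{N\to\infty}\frac1N\log\mathbb P[\mathcal T_N\ge sN]=-\Psi(s)\qquad\text{for } s\ge 6.$$ The convergence in the first line is uniform in $s\in K$ for every compact $K\subset[1,6]$, and in the second line for every compact $K\subset[6,\infty)$. Moreover $\Psi(6)=0$, $\Psi$ is differentiable in a neighbourhood of $6$ and twice differentiable at $6$, with $\Psi'(6)=0$ and $\Psi''(6)>0$. -/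

import Mathlib

open Filter Topology MeasureTheory
open scoped ENNReal

noncomputable section

/-- One-step transition probabilities of the lazy biased walk on `ℤ₊`: from `x` the walk moves to
`x + 1` with probability `1/3` and, when `x ≥ 1`, to `x - 1` with probability `1/6`; with the
remaining probability (`1/2` if `x ≥ 1`, and `2/3` if `x = 0`) it stays at `x`. -/
def walkStep (x y : ℕ) : ℝ :=
  if y = x + 1 then 1 / 3
  else if x = y + 1 then 1 / 6
  else if y = x then (if x = 0 then 2 / 3 else 1 / 2)
  else 0

/-- `Z` is a (time-homogeneous, discrete-time) Markov chain on the countable space `S` under `μ`,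
started at `x₀`, with transition matrix `p`. -/
structure IsMarkovChainFrom {Ω S : Type*} [MeasurableSpace Ω] [MeasurableSpace S]
    (μ : Measure Ω) (p : S → S → ℝ) (x₀ : S) (Z : ℕ → Ω → S) : Prop where
  measurable : ∀ t, Measurable (Z t)
  start : ∀ᵐ ω ∂μ, Z 0 ω = x₀
  path : ∀ (t : ℕ) (x : ℕ → S), x 0 = x₀ →
    μ.real {ω | ∀ i ≤ t, Z i ω = x i} = ∏ i ∈ Finset.range t, p (x i) (x (i + 1))

/-- The first time at which `Z` is at `N` (it is `⊤` if `Z` never visits `N`). -/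
def firstHit {Ω : Type*} (Z : ℕ → Ω → ℕ) (N : ℕ) (ω : Ω) : ℕ∞ :=
  hittingAfter Z {N} 0 ω

/-- The probability that the hitting time of `N` is equal to `⌊s N⌋` (for `s ≥ 0`). -/
def probHitEq {Ω : Type*} [MeasurableSpace Ω] (μ : Measure Ω) (Z : ℕ → Ω → ℕ) (N : ℕ) (s : ℝ) :
    ℝ :=
  μ.real {ω | firstHit Z N ω = (⌊s * N⌋₊ : ℕ∞)}

/-- The probability that the hitting time of `N` is at most `s N` (for `s ≥ 0`). -/
def probHitLE {Ω : Type*} [MeasurableSpace Ω] (μ : Measure Ω) (Z : ℕ → Ω → ℕ) (N : ℕ) (s : ℝ) :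
    ℝ :=
  μ.real {ω | (firstHit Z N ω : ℝ≥0∞) ≤ ENNReal.ofReal (s * N)}

/-- The probability that the hitting time of `N` is at least `s N` (for `s ≥ 0`). -/
def probHitGE {Ω : Type*} [MeasurableSpace Ω] (μ : Measure Ω) (Z : ℕ → Ω → ℕ) (N : ℕ) (s : ℝ) :
    ℝ :=
  μ.real {ω | ENNReal.ofReal (s * N) ≤ (firstHit Z N ω : ℝ≥0∞)}

/-- The explicit function whose logarithm is Legendre-transformed, with values in `[0, ∞]`. -/
def phi (l : ℝ) : ℝ≥0∞ :=
  if Real.log (6 / (3 + 2 * √2)) < l then ⊤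
  else ENNReal.ofReal
    ((6 * Real.exp (-l) - 3) / 2 - √((6 * Real.exp (-l) - 3) ^ 2 - 8) / 2)

/-- The Legendre transform of `log phi`, as an extended real number. -/
def PsiExt (s : ℝ) : EReal :=
  ⨆ l : ℝ, (((l * s : ℝ) : EReal) - ENNReal.log (phi l))

/-- The real-valued version of `PsiExt`, meaningful where `PsiExt` is finite. -/
def Psi (s : ℝ) : ℝ := (PsiExt s).toReal

end

/-! For 0 < x the function `tiltFun x`, a combination of (1/x)^k and (x/2)^k, satisfies r P g = g
with r = `tiltRate x`. Optional stopping at the hitting time T of N gives, for each m, E[g(Z_m) r^m;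
T > m] + g(N) E[r^T; T ≤ m] = g(0) = 2 - x^2 (`tilt_martingale`). When x^2 < 2, g(k) is comparable
to x^(-k), so this says essentially that E[r^T] is of order x^N. Accordingly `phi (log r)` = x, and
the Legendre transform becomes the supremum over x of s log r - log x, attained for s > 1 at the
explicit point `tiltRoot s` (`PsiExt_eq_rate`).

Upper bounds are Chernoff bounds. Dropping one of the two nonnegative terms and taking x = `tiltRoot
s` controls the lower tail when x ≤ 1 (s ≤ 6) and the upper tail when x ≥ 1 (s ≥ 6). They hold for
every N ≥ 1 with explicit constants, hence uniformly in s.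

For the lower bound, take u < t < s close together and x = `tiltRoot t`. Comparison with the tilts
optimal for s and u shows that paths with T > sN or T ≤ uN carry an exponentially small share of the
identity, so times in (uN, sN] carry a fixed share. Since the walk can wait at the origin with
probability 2/3 per step (`hitLaw_add_ge`), that mass moves to the single time ⌊sN⌋ at small
exponential cost (`eventually_exp_le_hitLaw_of_one_lt`). Waiting also spreads the bound to a
neighbourhood of s; lower semicontinuity of the rate and compactness then give uniformity.

The derivative of the rate is log r at the maximiser, by the envelope principle, from which the
behaviour at 6 is read off. -/

/-! ### The walk killed at level `N` -/

/-- The law at time `m` of the walk from `0`, restricted to the paths staying below `N`. -/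
noncomputable def killedLaw (N : ℕ) : ℕ → ℕ → ℝ
  | 0, k => if k = 0 then 1 else 0
  | m + 1, k => ∑ j ∈ Finset.range N, killedLaw N m j * walkStep j k

/-- The law of the hitting time of `N` for the walk from `0`. -/
noncomputable def hitLaw (N : ℕ) : ℕ → ℝ
  | 0 => 0
  | m + 1 => ∑ j ∈ Finset.range N, killedLaw N m j * walkStep j N

theorem walkStep_nonneg (x y : ℕ) : 0 ≤ walkStep x y := by
  unfold walkStep; split_ifs <;> norm_num

theorem killedLaw_nonneg (N m k : ℕ) : 0 ≤ killedLaw N m k := by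
  induction m generalizing k with
  | zero => unfold killedLaw; split_ifs <;> norm_num
  | succ m ih =>
    exact Finset.sum_nonneg fun j _ => mul_nonneg (ih j) (walkStep_nonneg _ _)

theorem hitLaw_nonneg (N n : ℕ) : 0 ≤ hitLaw N n := by
  cases n with
  | zero => exact le_rfl
  | succ m =>
    exact Finset.sum_nonneg fun j _ => mul_nonneg (killedLaw_nonneg N m j) (walkStep_nonneg _ _)

/-- Prefixing a path by one holding step at the origin costs a factor 2/3. Only the base case uses
this; the linear, time-homogeneous recursion propagates it. -/
theorem killedLaw_succ_ge {N : ℕ} (hN : 1 ≤ N) (m k : ℕ) :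
    2 / 3 * killedLaw N m k ≤ killedLaw N (m + 1) k := by
  induction m generalizing k with
  | zero =>
    rw [killedLaw, killedLaw]
    by_cases hk : k = 0
    · subst hk
      have h := Finset.single_le_sum (s := Finset.range N)
        (f := fun j => killedLaw N 0 j * walkStep j 0)
        (fun j _ => mul_nonneg (killedLaw_nonneg N 0 j) (walkStep_nonneg _ _))
        (Finset.mem_range.2 hN)
      simpa [killedLaw, walkStep] using h
    · simp only [hk, if_false, mul_zero]
      exact Finset.sum_nonneg fun j _ => mul_nonneg (killedLaw_nonneg N 0 j) (walkStep_nonneg _ _)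
  | succ m ih =>
    rw [killedLaw, killedLaw, Finset.mul_sum]
    refine Finset.sum_le_sum fun j _ => ?_
    rw [← mul_assoc]
    exact mul_le_mul_of_nonneg_right (ih j) (walkStep_nonneg _ _)

theorem hitLaw_succ_ge {N : ℕ} (hN : 1 ≤ N) (n : ℕ) :
    2 / 3 * hitLaw N n ≤ hitLaw N (n + 1) := by
  cases n with
  | zero => simpa [hitLaw] using hitLaw_nonneg N 1
  | succ m =>
    rw [hitLaw, hitLaw, Finset.mul_sum]
    refine Finset.sum_le_sum fun j _ => ?_
    rw [← mul_assoc]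
    exact mul_le_mul_of_nonneg_right (killedLaw_succ_ge hN m j) (walkStep_nonneg _ _)

theorem hitLaw_add_ge {N : ℕ} (hN : 1 ≤ N) (n k : ℕ) :
    (2 / 3 : ℝ) ^ k * hitLaw N n ≤ hitLaw N (n + k) := by
  induction k with
  | zero => simp
  | succ k ih =>
    have := hitLaw_succ_ge hN (n + k)
    rw [pow_succ, ← add_assoc]
    linarith

theorem killedLaw_diag_ge {N m : ℕ} (hm : m ≤ N) : (1 / 3 : ℝ) ^ m ≤ killedLaw N m m := by
  induction m with
  | zero => simp [killedLaw]
  | succ m ih =>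
    have h := Finset.single_le_sum (s := Finset.range N)
        (f := fun j => killedLaw N m j * walkStep j (m + 1))
        (fun j _ => mul_nonneg (killedLaw_nonneg N m j) (walkStep_nonneg _ _))
        (Finset.mem_range.2 hm)
    rw [killedLaw]
    refine le_trans ?_ h
    have := ih (by omega)
    simp only [walkStep, if_true, pow_succ]
    linarith

theorem hitLaw_self_ge {N : ℕ} (hN : 1 ≤ N) : (1 / 3 : ℝ) ^ N ≤ hitLaw N N := by
  obtain ⟨m, rfl⟩ : ∃ m, N = m + 1 := ⟨N - 1, by omega⟩
  exact killedLaw_diag_ge le_rfl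

theorem hitLaw_pos {N n : ℕ} (hN : 1 ≤ N) (hn : N ≤ n) : 0 < hitLaw N n := by
  obtain ⟨k, rfl⟩ := Nat.exists_eq_add_of_le hn
  refine lt_of_lt_of_le ?_ (hitLaw_add_ge hN N k)
  exact mul_pos (by positivity) (lt_of_lt_of_le (by positivity) (hitLaw_self_ge hN))

/-! ### Action of the transition matrix on functions, and optional stopping -/

theorem sum_walkStep_mul_zero {M : ℕ} (hM : 2 ≤ M) (g : ℕ → ℝ) :
    ∑ k ∈ Finset.range M, walkStep 0 k * g k = 2 / 3 * g 0 + 1 / 3 * g 1 := by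
  rw [← Finset.sum_subset (s₁ := Finset.range 2) (by simpa using hM)]
  · simp [Finset.sum_range_succ, walkStep]
  · intro k _ hk
    simp only [Finset.mem_range, not_lt] at hk
    have : walkStep 0 k = 0 := by
      unfold walkStep
      rw [if_neg (by omega), if_neg (by omega), if_neg (by omega)]
    simp [this]

theorem sum_walkStep_mul_succ {M j : ℕ} (hM : j + 3 ≤ M) (g : ℕ → ℝ) :
    ∑ k ∈ Finset.range M, walkStep (j + 1) k * g k
      = 1 / 6 * g j + 1 / 2 * g (j + 1) + 1 / 3 * g (j + 2) := by
  rw [← Finset.sum_subset (s₁ := {j, j + 1, j + 2})]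
  · rw [Finset.sum_insert (by simp), Finset.sum_insert (by simp), Finset.sum_singleton]
    have h1 : walkStep (j + 1) j = 1 / 6 := by
      unfold walkStep
      rw [if_neg (by omega), if_pos rfl]
    have h2 : walkStep (j + 1) (j + 1) = 1 / 2 := by simp [walkStep]
    have h3 : walkStep (j + 1) (j + 2) = 1 / 3 := by simp [walkStep]
    rw [h1, h2, h3, add_assoc]
  · intro k hk
    simp only [Finset.mem_insert, Finset.mem_singleton] at hk
    simp only [Finset.mem_range]
    omega
  · intro k _ hk
    simp only [Finset.mem_insert, Finset.mem_singleton, not_or] at hk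
    have : walkStep (j + 1) k = 0 := by
      unfold walkStep
      rw [if_neg (by omega), if_neg (by omega), if_neg (by omega)]
    simp [this]

/-- Optional stopping for a function `g` with `r * P g = g`. -/
theorem killedLaw_martingale {N : ℕ} (hN : 1 ≤ N) {g : ℕ → ℝ} {r : ℝ}
    (hg : ∀ j < N, r * ∑ k ∈ Finset.range (N + 1), walkStep j k * g k = g j) (m : ℕ) :
    (∑ k ∈ Finset.range N, killedLaw N m k * g k) * r ^ m
      + g N * ∑ j ∈ Finset.range (m + 1), hitLaw N j * r ^ j = g 0 := by
  induction m with
  | zero =>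
    have : 0 < N := hN
    simp [killedLaw, hitLaw, this]
  | succ m ih =>
    rw [Finset.sum_range_succ, ← ih]
    -- One step of the walk from below N lands in {0, ..., N}; the mass landing on N is exactly the
    -- hitting mass at time m + 1.
    have key : (∑ k ∈ Finset.range N, killedLaw N (m + 1) k * g k) * r + g N * hitLaw N (m + 1) * r
        = ∑ k ∈ Finset.range N, killedLaw N m k * g k := by
      have e1 : (∑ k ∈ Finset.range N, killedLaw N (m + 1) k * g k) + g N * hitLaw N (m + 1)
          = ∑ k ∈ Finset.range (N + 1), (∑ j ∈ Finset.range N, killedLaw N m j * walkStep j k)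
              * g k := by
        rw [Finset.sum_range_succ]
        congr 1
        rw [mul_comm]; rfl
      rw [← add_mul, e1]
      simp_rw [Finset.sum_mul]
      rw [Finset.sum_comm]
      refine Finset.sum_congr rfl fun j hj => ?_
      rw [← hg j (Finset.mem_range.1 hj), Finset.mul_sum, Finset.mul_sum]
      exact Finset.sum_congr rfl fun k _ => by ring
    rw [← key]
    ring

/-! ### Exponential martingales -/

/-- `tiltRate x` is the value of `exp l` for which `phi l = x`. -/
noncomputable def tiltRate (x : ℝ) : ℝ := 6 * x / ((x + 1) * (x + 2))

/-- The function with `tiltRate x * P g = g` for the transition matrix `P` of the walk. -/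
noncomputable def tiltFun (x : ℝ) (k : ℕ) : ℝ := (2 - x) * (x⁻¹) ^ k + x * (1 - x) * (x / 2) ^ k

theorem tiltRate_pos {x : ℝ} (hx : 0 < x) : 0 < tiltRate x := by
  unfold tiltRate; positivity

/-- Away from 0 the equation is a second-order recurrence whose characteristic roots have product
1/2; they are 1/x and x/2. The coefficients 2 - x and x(1 - x) are those matching the boundary
condition at 0. -/
theorem tiltFun_harmonic {x : ℝ} (hx : 0 < x) {N j : ℕ} (hj : j < N) :
    tiltRate x * ∑ k ∈ Finset.range (N + 1), walkStep j k * tiltFun x k = tiltFun x j := by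
  cases j with
  | zero =>
    rw [sum_walkStep_mul_zero (by omega)]
    unfold tiltRate tiltFun
    field_simp
    ring
  | succ j =>
    rw [sum_walkStep_mul_succ (by omega)]
    unfold tiltRate tiltFun
    simp only [pow_succ]
    generalize (x⁻¹) ^ j = A
    generalize (x / 2) ^ j = B
    field_simp
    ring

theorem tiltFun_zero (x : ℝ) : tiltFun x 0 = 2 - x ^ 2 := by
  unfold tiltFun; ring

theorem div_two_pow_le_inv_pow {x : ℝ} (hx : 0 < x) (hx2 : x ^ 2 < 2) (k : ℕ) :
    (x / 2) ^ k ≤ (x⁻¹) ^ k := by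
  refine pow_le_pow_left₀ (by positivity) ?_ k
  rw [← one_div, div_le_div_iff₀ (by norm_num) hx]
  nlinarith

theorem tiltFun_le {x : ℝ} (hx : 0 < x) (hx2 : x ^ 2 < 2) (k : ℕ) :
    tiltFun x k ≤ 2 * (x⁻¹) ^ k := by
  have h1 := div_two_pow_le_inv_pow hx hx2 k
  have h2 : 0 < (x / 2) ^ k := by positivity
  unfold tiltFun
  rcases le_total x 1 with h | h
  · have : x * (1 - x) * (x / 2) ^ k ≤ x * (1 - x) * (x⁻¹) ^ k :=
      mul_le_mul_of_nonneg_left h1 (mul_nonneg hx.le (by linarith))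
    nlinarith [mul_pos (pow_pos hx 2) (h2.trans_le h1)]
  · have : x * (x - 1) * (x / 2) ^ k ≥ 0 :=
      mul_nonneg (mul_nonneg hx.le (by linarith)) h2.le
    nlinarith [mul_pos hx (h2.trans_le h1)]

/-- The constant is half of g(0), so that it cancels against the right side of the martingale
identity and leaves bounds with the constant 2, independent of x. -/
theorem le_tiltFun {x : ℝ} (hx : 0 < x) (hx2 : x ^ 2 < 2) (k : ℕ) :
    (2 - x ^ 2) / 2 * (x⁻¹) ^ k ≤ tiltFun x k := by
  have h1 := div_two_pow_le_inv_pow hx hx2 k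
  have h2 : 0 < (x / 2) ^ k := by positivity
  have h3 := h2.trans_le h1
  unfold tiltFun
  rcases le_total x 1 with h | h
  · have : x * (1 - x) * (x / 2) ^ k ≥ 0 :=
      mul_nonneg (mul_nonneg hx.le (by linarith)) h2.le
    nlinarith [mul_nonneg (sq_nonneg (x - 1)) h3.le]
  · have : x * (x - 1) * (x / 2) ^ k ≤ x * (x - 1) * (x⁻¹) ^ k :=
      mul_le_mul_of_nonneg_left h1 (mul_nonneg hx.le (by linarith))
    nlinarith [mul_pos (sub_pos.2 hx2) h3]

theorem tiltFun_pos {x : ℝ} (hx : 0 < x) (hx2 : x ^ 2 < 2) (k : ℕ) : 0 < tiltFun x k :=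
  lt_of_lt_of_le (mul_pos (by linarith) (by positivity)) (le_tiltFun hx hx2 k)

theorem tilt_martingale {N : ℕ} (hN : 1 ≤ N) {x : ℝ} (hx : 0 < x) (m : ℕ) :
    (∑ k ∈ Finset.range N, killedLaw N m k * tiltFun x k) * tiltRate x ^ m
      + tiltFun x N * ∑ j ∈ Finset.range (m + 1), hitLaw N j * tiltRate x ^ j = 2 - x ^ 2 := by
  rw [killedLaw_martingale hN (fun j hj => tiltFun_harmonic hx hj), tiltFun_zero]

theorem sum_hitLaw_mul_pow_le {N : ℕ} (hN : 1 ≤ N) {x : ℝ} (hx : 0 < x) (hx2 : x ^ 2 < 2)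
    (m : ℕ) : ∑ j ∈ Finset.range (m + 1), hitLaw N j * tiltRate x ^ j ≤ 2 * x ^ N := by
  have h := tilt_martingale hN hx m
  have h1 : 0 ≤ (∑ k ∈ Finset.range N, killedLaw N m k * tiltFun x k) * tiltRate x ^ m :=
    mul_nonneg (Finset.sum_nonneg fun k _ =>
      mul_nonneg (killedLaw_nonneg _ _ _) (tiltFun_pos hx hx2 k).le)
      (pow_nonneg (tiltRate_pos hx).le _)
  have h2 : 0 ≤ ∑ j ∈ Finset.range (m + 1), hitLaw N j * tiltRate x ^ j :=
    Finset.sum_nonneg fun j _ => mul_nonneg (hitLaw_nonneg _ _) (pow_nonneg (tiltRate_pos hx).le _)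
  set S := ∑ j ∈ Finset.range (m + 1), hitLaw N j * tiltRate x ^ j
  have h3 := mul_le_mul_of_nonneg_right (le_tiltFun hx hx2 N) h2
  have h4 : (2 - x ^ 2) / 2 * ((x⁻¹) ^ N * S) ≤ (2 - x ^ 2) / 2 * 2 := by
    rw [← mul_assoc]; linarith
  have h5 := le_of_mul_le_mul_left h4 (by linarith)
  rw [inv_pow, inv_mul_le_iff₀ (by positivity)] at h5
  linarith

theorem sum_killedLaw_mul_inv_pow_le {N : ℕ} (hN : 1 ≤ N) {x : ℝ} (hx : 0 < x) (hx2 : x ^ 2 < 2)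
    (m : ℕ) :
    (∑ k ∈ Finset.range N, killedLaw N m k * (x⁻¹) ^ k) * tiltRate x ^ m ≤ 2 := by
  have h := tilt_martingale hN hx m
  have hr := tiltRate_pos hx
  have h2 : 0 ≤ tiltFun x N * ∑ j ∈ Finset.range (m + 1), hitLaw N j * tiltRate x ^ j :=
    mul_nonneg (tiltFun_pos hx hx2 N).le (Finset.sum_nonneg fun j _ =>
      mul_nonneg (hitLaw_nonneg _ _) (pow_nonneg hr.le _))
  have h3 : (2 - x ^ 2) / 2 * (∑ k ∈ Finset.range N, killedLaw N m k * (x⁻¹) ^ k)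
      ≤ ∑ k ∈ Finset.range N, killedLaw N m k * tiltFun x k := by
    rw [Finset.mul_sum]
    refine Finset.sum_le_sum fun k _ => ?_
    rw [mul_left_comm]
    exact mul_le_mul_of_nonneg_left (le_tiltFun hx hx2 k) (killedLaw_nonneg _ _ _)
  have h4 := mul_le_mul_of_nonneg_right h3 (pow_nonneg hr.le m)
  have h5 : (2 - x ^ 2) / 2 * ((∑ k ∈ Finset.range N, killedLaw N m k * (x⁻¹) ^ k)
      * tiltRate x ^ m) ≤ (2 - x ^ 2) / 2 * 2 := by
    rw [← mul_assoc]; linarith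
  exact le_of_mul_le_mul_left h5 (by linarith)

/-! ### The Markov property -/

/-- The prefix takes values in a countable space, so two measures on it agree once they agree on
singletons, where the path formula applies. -/
theorem IsMarkovChainFrom.real_prefix_step {Ω S : Type*} [MeasurableSpace Ω] [MeasurableSpace S]
    [Countable S] [MeasurableSingletonClass S] {μ : Measure Ω} [IsProbabilityMeasure μ]
    {p : S → S → ℝ} {x₀ : S} {Z : ℕ → Ω → S} (hp : ∀ x y, 0 ≤ p x y)
    (hZ : IsMarkovChainFrom μ p x₀ Z) (m : ℕ) (A : Set (Fin (m + 1) → S)) (j k : S) :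
    μ.real {ω | (fun i : Fin (m + 1) => Z i ω) ∈ A ∧ Z m ω = j ∧ Z (m + 1) ω = k}
      = μ.real {ω | (fun i : Fin (m + 1) => Z i ω) ∈ A ∧ Z m ω = j} * p j k := by
  set pre : Ω → Fin (m + 1) → S := fun ω i => Z i ω with hpre
  have hm : Measurable pre := measurable_pi_lambda _ fun i => hZ.measurable i
  have hsj : ∀ t y, MeasurableSet {ω | Z t ω = y} := fun t y =>
    hZ.measurable t (measurableSet_singleton y)
  have hA : ∀ B : Set (Fin (m + 1) → S), MeasurableSet B := fun B => B.to_countable.measurableSet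
  have key : (μ.restrict {ω | Z m ω = j ∧ Z (m + 1) ω = k}).map pre
      = ENNReal.ofReal (p j k) • (μ.restrict {ω | Z m ω = j}).map pre := by
    rw [Measure.ext_iff_singleton]
    intro v
    rw [Measure.smul_apply, Measure.map_apply hm (hA _), Measure.map_apply hm (hA _),
      Measure.restrict_apply (hm (hA _)), Measure.restrict_apply (hm (hA _)), smul_eq_mul]
    by_cases hv : v (Fin.last m) = j
    swap
    · have e : ∀ ω, pre ω = v → Z m ω ≠ j := by
        rintro ω rfl h
        exact hv h
      have e1 : pre ⁻¹' {v} ∩ {ω | Z m ω = j ∧ Z (m + 1) ω = k} = ∅ := by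
        ext ω; simp only [Set.mem_inter_iff, Set.mem_preimage, Set.mem_singleton_iff,
          Set.mem_ofPred_eq, Set.mem_empty_iff_false, iff_false]
        rintro ⟨h1, h2, -⟩
        exact e ω h1 h2
      have e2 : pre ⁻¹' {v} ∩ {ω | Z m ω = j} = ∅ := by
        ext ω; simp only [Set.mem_inter_iff, Set.mem_preimage, Set.mem_singleton_iff,
          Set.mem_ofPred_eq, Set.mem_empty_iff_false, iff_false]
        rintro ⟨h1, h2⟩
        exact e ω h1 h2
      rw [e1, e2]; simp
    by_cases hv0 : v 0 = x₀
    swap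
    · have e : μ (pre ⁻¹' {v}) = 0 := by
        refine measure_mono_null ?_ (ae_iff.1 hZ.start)
        intro ω hω h
        have h1 : pre ω = v := hω
        exact hv0 (by rw [← h1, ← h]; rfl)
      rw [measure_mono_null Set.inter_subset_left e, measure_mono_null Set.inter_subset_left e,
        mul_zero]
    -- The prefix v continued by k; only the value at time m + 1 matters beyond the prefix.
    set x : ℕ → S := fun i => if h : i < m + 1 then v ⟨i, h⟩ else k with hx
    have hx0 : x 0 = x₀ := by simpa [hx] using hv0
    have hxm : x m = j := by rw [← hv]; simp [hx, Fin.last]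
    have hxm1 : x (m + 1) = k := by simp [hx]
    have hpv : ∀ ω, pre ω = v ↔ ∀ i ≤ m, Z i ω = x i := by
      intro ω
      rw [funext_iff]
      constructor
      · intro h i hi
        have := h ⟨i, by omega⟩
        simp only [hx, show i < m + 1 by omega, dif_pos]
        exact this
      · intro h i
        have := h i (by omega)
        simp only [hx, i.2, dif_pos] at this
        exact this
    have e1 : pre ⁻¹' {v} ∩ {ω | Z m ω = j ∧ Z (m + 1) ω = k}
        = {ω | ∀ i ≤ m + 1, Z i ω = x i} := by
      ext ω
      simp only [Set.mem_inter_iff, Set.mem_preimage, Set.mem_singleton_iff, Set.mem_ofPred_eq, hpv]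
      constructor
      · rintro ⟨h1, -, h3⟩ i hi
        rcases Nat.lt_or_ge m i with h | h
        · obtain rfl : i = m + 1 := by omega
          rw [h3, hxm1]
        · exact h1 i h
      · intro h
        exact ⟨fun i hi => h i (by omega), by rw [h m (by omega), hxm], by rw [h _ le_rfl, hxm1]⟩
    have e2 : pre ⁻¹' {v} ∩ {ω | Z m ω = j} = {ω | ∀ i ≤ m, Z i ω = x i} := by
      ext ω
      simp only [Set.mem_inter_iff, Set.mem_preimage, Set.mem_singleton_iff, Set.mem_ofPred_eq, hpv]
      exact ⟨fun h => h.1, fun h => ⟨h, by rw [h m le_rfl, hxm]⟩⟩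
    have p1 := hZ.path (m + 1) x hx0
    rw [Finset.prod_range_succ, ← hZ.path m x hx0, hxm, hxm1] at p1
    rw [e1, e2, ← ofReal_measureReal, p1, ENNReal.ofReal_mul measureReal_nonneg,
      ofReal_measureReal, mul_comm]
  have h := congrArg (fun ν => ν A) key
  simp only [Measure.smul_apply, Measure.map_apply hm (hA _), smul_eq_mul,
    Measure.restrict_apply (hm (hA _))] at h
  have h' := congrArg ENNReal.toReal h
  rw [ENNReal.toReal_mul, ENNReal.toReal_ofReal (hp _ _), mul_comm] at h'
  exact h'

/-! ### Identification of the hitting-time law with the killed walk -/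

theorem firstHit_le_iff {Ω : Type*} {Z : ℕ → Ω → ℕ} {N n : ℕ} {ω : Ω} :
    firstHit Z N ω ≤ (n : ℕ∞) ↔ ∃ j ≤ n, Z j ω = N := by
  have := hittingAfter_le_iff (u := Z) (s := {N}) (n := 0) (i := n) (ω := ω)
  exact this.trans (by simp)

theorem lt_firstHit_iff {Ω : Type*} {Z : ℕ → Ω → ℕ} {N n : ℕ} {ω : Ω} :
    (n : ℕ∞) < firstHit Z N ω ↔ ∀ j ≤ n, Z j ω ≠ N := by
  rw [← not_le, firstHit_le_iff]
  push Not
  rfl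

theorem firstHit_eq_succ_iff {Ω : Type*} {Z : ℕ → Ω → ℕ} {N n : ℕ} {ω : Ω} :
    firstHit Z N ω = ((n + 1 : ℕ) : ℕ∞) ↔ (∀ j ≤ n, Z j ω ≠ N) ∧ Z (n + 1) ω = N := by
  rw [← lt_firstHit_iff]
  constructor
  · intro h
    have h1 : (n : ℕ∞) < firstHit Z N ω := by rw [h]; exact_mod_cast Nat.lt_succ_self n
    refine ⟨h1, ?_⟩
    obtain ⟨j, hj, hjN⟩ := firstHit_le_iff.1 h.le
    rcases Nat.lt_or_ge n j with h2 | h2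
    · obtain rfl : j = n + 1 := by omega
      exact hjN
    · exact absurd hjN (lt_firstHit_iff.1 h1 j h2)
  · rintro ⟨h1, h2⟩
    refine le_antisymm (firstHit_le_iff.2 ⟨n + 1, le_rfl, h2⟩) ?_
    rw [Nat.cast_add, Nat.cast_one]
    exact Order.add_one_le_of_lt h1

section

variable {Ω : Type*} [MeasurableSpace Ω] {μ : Measure Ω} [IsProbabilityMeasure μ]
  {Z : ℕ → Ω → ℕ}

theorem real_below_step (hZ : IsMarkovChainFrom μ walkStep 0 Z) (N m j k : ℕ) :
    μ.real {ω | (∀ i ≤ m, Z i ω < N) ∧ Z m ω = j ∧ Z (m + 1) ω = k}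
      = μ.real {ω | (∀ i ≤ m, Z i ω < N) ∧ Z m ω = j} * walkStep j k := by
  have h := hZ.real_prefix_step walkStep_nonneg m {v | ∀ i, v i < N} j k
  have e : ∀ ω, (fun i : Fin (m + 1) => Z i ω) ∈ {v : Fin (m + 1) → ℕ | ∀ i, v i < N}
      ↔ ∀ i ≤ m, Z i ω < N := fun ω =>
    ⟨fun h i hi => h ⟨i, by omega⟩, fun h i => h i (by omega)⟩
  simp only [e] at h
  exact h

theorem measurableSet_below (hZ : ∀ t, Measurable (Z t)) (N m : ℕ) :
    MeasurableSet {ω | ∀ i ≤ m, Z i ω < N} := by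
  have : {ω | ∀ i ≤ m, Z i ω < N} = ⋂ i ∈ Set.Iic m, Z i ⁻¹' (Set.Iio N) := by
    ext; simp
  rw [this]
  exact MeasurableSet.biInter (Set.to_countable _) fun i _ => hZ i measurableSet_Iio

theorem real_below_eq_sum (hZ : ∀ t, Measurable (Z t)) (N m : ℕ) {B : Set Ω}
    (hB : MeasurableSet B) :
    μ.real {ω | (∀ i ≤ m, Z i ω < N) ∧ ω ∈ B}
      = ∑ j ∈ Finset.range N, μ.real {ω | (∀ i ≤ m, Z i ω < N) ∧ Z m ω = j ∧ ω ∈ B} := by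
  rw [← measureReal_biUnion_finset]
  · congr 1
    ext ω
    simp only [Set.mem_ofPred_eq, Set.mem_iUnion, Finset.mem_range, exists_prop]
    constructor
    · rintro ⟨h1, h2⟩
      exact ⟨Z m ω, h1 m le_rfl, h1, rfl, h2⟩
    · rintro ⟨j, -, h1, -, h2⟩
      exact ⟨h1, h2⟩
  · intro i _ j _ hij
    refine Set.disjoint_left.2 fun ω h1 h2 => hij ?_
    rw [← h1.2.1, ← h2.2.1]
  · intro j _
    exact (measurableSet_below hZ N m).inter ((hZ m (measurableSet_singleton j)).inter hB)

theorem real_below_eq_killedLaw (hZ : IsMarkovChainFrom μ walkStep 0 Z) {N m k : ℕ} (hk : k < N) :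
    μ.real {ω | (∀ i ≤ m, Z i ω < N) ∧ Z m ω = k} = killedLaw N m k := by
  induction m generalizing k with
  | zero =>
    rw [killedLaw]
    split_ifs with h
    · subst h
      rw [← probReal_univ (μ := μ)]
      refine measureReal_congr ?_
      filter_upwards [hZ.start] with ω hω
      refine propext ⟨fun _ => trivial, fun _ => ⟨fun i hi => ?_, hω⟩⟩
      rw [Nat.le_zero.1 hi, hω]
      exact hk
    · have : μ {ω | (∀ i ≤ 0, Z i ω < N) ∧ Z 0 ω = k} = 0 := by
        refine measure_mono_null ?_ (ae_iff.1 hZ.start)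
        intro ω hω h0
        exact h (hω.2.symm.trans h0)
      rw [measureReal_def, this, ENNReal.toReal_zero]
  | succ m ih =>
    have e : {ω | (∀ i ≤ m + 1, Z i ω < N) ∧ Z (m + 1) ω = k}
        = {ω | (∀ i ≤ m, Z i ω < N) ∧ ω ∈ {ω | Z (m + 1) ω = k}} := by
      ext ω
      simp only [Set.mem_ofPred_eq]
      constructor
      · rintro ⟨h1, h2⟩
        exact ⟨fun i hi => h1 i (by omega), h2⟩
      · rintro ⟨h1, h2⟩
        refine ⟨fun i hi => ?_, h2⟩
        rcases Nat.lt_or_ge m i with h | h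
        · obtain rfl : i = m + 1 := by omega
          omega
        · exact h1 i h
    rw [e, real_below_eq_sum hZ.measurable N m (B := {ω | Z (m + 1) ω = k})
      (hZ.measurable (m + 1) (measurableSet_singleton k)),
      killedLaw]
    refine Finset.sum_congr rfl fun j hj => ?_
    rw [← ih (Finset.mem_range.1 hj), ← real_below_step hZ]
    rfl

theorem ae_step_le (hZ : IsMarkovChainFrom μ walkStep 0 Z) :
    ∀ᵐ ω ∂μ, ∀ m, Z (m + 1) ω ≤ Z m ω + 1 := by
  rw [ae_all_iff]
  intro m
  have h : ∀ j k : ℕ, ∀ᵐ ω ∂μ, j + 1 < k → ¬ (Z m ω = j ∧ Z (m + 1) ω = k) := by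
    intro j k
    by_cases hjk : j + 1 < k
    · have h := hZ.real_prefix_step walkStep_nonneg m Set.univ j k
      have hp : walkStep j k = 0 := by
        unfold walkStep
        rw [if_neg (by omega), if_neg (by omega), if_neg (by omega)]
      rw [hp, mul_zero, measureReal_eq_zero_iff] at h
      rw [ae_iff]
      convert h using 2
      ext ω
      simp [hjk]
    · exact Eventually.of_forall fun ω h => absurd h hjk
  have h' : ∀ᵐ ω ∂μ, ∀ j k : ℕ, j + 1 < k → ¬ (Z m ω = j ∧ Z (m + 1) ω = k) := by
    rw [ae_all_iff]
    intro j
    rw [ae_all_iff]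
    exact h j
  filter_upwards [h'] with ω hω
  by_contra hlt
  exact hω _ _ (not_le.1 hlt) ⟨rfl, rfl⟩

/-- Upward jumps have size at most one, so the walk cannot pass N without visiting it. This links
the hitting time, phrased by avoiding N, with the killed law, phrased by staying below N. -/
theorem ae_ne_iff_below (hZ : IsMarkovChainFrom μ walkStep 0 Z) {N : ℕ} (hN : 1 ≤ N) :
    ∀ᵐ ω ∂μ, ∀ m, (∀ i ≤ m, Z i ω ≠ N) ↔ ∀ i ≤ m, Z i ω < N := by
  filter_upwards [hZ.start, ae_step_le hZ] with ω h0 h1 m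
  refine ⟨fun h i => ?_, fun h i hi => (h i hi).ne⟩
  induction i with
  | zero => intro _; omega
  | succ i ih =>
    intro hi
    have a := ih (by omega)
    have b := h1 i
    have c := h (i + 1) hi
    omega

theorem real_firstHit_eq (hZ : IsMarkovChainFrom μ walkStep 0 Z) {N : ℕ} (hN : 1 ≤ N) (n : ℕ) :
    μ.real {ω | firstHit Z N ω = n} = hitLaw N n := by
  cases n with
  | zero =>
    have : μ {ω | firstHit Z N ω = ((0 : ℕ) : ℕ∞)} = 0 := by
      refine measure_mono_null ?_ (ae_iff.1 hZ.start)
      intro ω hω h0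
      obtain ⟨j, hj, hjN⟩ := firstHit_le_iff.1 (le_of_eq hω)
      obtain rfl : j = 0 := by omega
      omega
    rw [measureReal_def, this, ENNReal.toReal_zero, hitLaw]
  | succ m =>
    have e : μ.real {ω | firstHit Z N ω = ((m + 1 : ℕ) : ℕ∞)}
        = μ.real {ω | (∀ i ≤ m, Z i ω < N) ∧ ω ∈ {ω | Z (m + 1) ω = N}} := by
      refine measureReal_congr ?_
      filter_upwards [ae_ne_iff_below hZ hN] with ω hω
      refine propext ?_
      exact firstHit_eq_succ_iff.trans (and_congr_left fun _ => hω m)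
    rw [e, real_below_eq_sum hZ.measurable N m (B := {ω | Z (m + 1) ω = N})
      (hZ.measurable (m + 1) (measurableSet_singleton N)),
      hitLaw]
    refine Finset.sum_congr rfl fun j hj => ?_
    rw [← real_below_eq_killedLaw hZ (Finset.mem_range.1 hj), ← real_below_step hZ]
    rfl

theorem real_lt_firstHit (hZ : IsMarkovChainFrom μ walkStep 0 Z) {N : ℕ} (hN : 1 ≤ N) (n : ℕ) :
    μ.real {ω | (n : ℕ∞) < firstHit Z N ω} = ∑ k ∈ Finset.range N, killedLaw N n k := by
  have e : μ.real {ω | (n : ℕ∞) < firstHit Z N ω}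
      = μ.real {ω | (∀ i ≤ n, Z i ω < N) ∧ ω ∈ Set.univ} := by
    refine measureReal_congr ?_
    filter_upwards [ae_ne_iff_below hZ hN] with ω hω
    refine propext ?_
    exact lt_firstHit_iff.trans ((hω n).trans (and_iff_left (Set.mem_univ ω)).symm)
  rw [e, real_below_eq_sum hZ.measurable N n MeasurableSet.univ]
  refine Finset.sum_congr rfl fun j hj => ?_
  rw [← real_below_eq_killedLaw hZ (Finset.mem_range.1 hj)]
  simp

theorem real_firstHit_le (hZ : IsMarkovChainFrom μ walkStep 0 Z) {N : ℕ} (hN : 1 ≤ N) (n : ℕ) :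
    μ.real {ω | firstHit Z N ω ≤ n} ≤ ∑ j ∈ Finset.range (n + 1), hitLaw N j := by
  have e : {ω | firstHit Z N ω ≤ n} ⊆ ⋃ j ∈ Finset.range (n + 1), {ω | firstHit Z N ω = j} := by
    intro ω hω
    obtain ⟨j, hj⟩ := ENat.ne_top_iff_exists.1 (ne_top_of_le_ne_top (ENat.natCast_ne_top n) hω)
    simp only [Set.mem_ofPred_eq, ← hj, Nat.cast_le] at hω
    simp only [Set.mem_iUnion, Finset.mem_range]
    exact ⟨j, by omega, hj.symm⟩
  refine (measureReal_mono e (measure_ne_top _ _)).trans ((measureReal_biUnion_finset_le _ _).trans ?_)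
  exact Finset.sum_le_sum fun j _ => (real_firstHit_eq hZ hN j).le

end

/-! ### The rate function -/

/-- The exponent `l * s - log (phi l)` at `l = log (tiltRate x)`. -/
noncomputable def tiltExponent (s x : ℝ) : ℝ := s * Real.log (tiltRate x) - Real.log x

/-- The maximiser of `tiltExponent s`. -/
noncomputable def tiltRoot (s : ℝ) : ℝ := (√(8 * s ^ 2 + 1) - 3) / (2 * (s + 1))

theorem sqrt_eight_mul_sq_add_one {s : ℝ} (hs : 1 < s) : 3 < √(8 * s ^ 2 + 1) := by
  rw [Real.lt_sqrt (by norm_num)]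
  nlinarith

theorem tiltRoot_pos {s : ℝ} (hs : 1 < s) : 0 < tiltRoot s :=
  div_pos (by linarith [sqrt_eight_mul_sq_add_one hs]) (by linarith)

/-- This is the critical-point equation in x of `tiltExponent s`, cleared of denominators. -/
theorem tiltRoot_eq {s : ℝ} (hs : 1 < s) :
    (tiltRoot s + 1) * (tiltRoot s + 2) = s * (2 - tiltRoot s ^ 2) := by
  have h := Real.sq_sqrt (show (0 : ℝ) ≤ 8 * s ^ 2 + 1 by positivity)
  unfold tiltRoot
  set q := √(8 * s ^ 2 + 1)
  have : s + 1 ≠ 0 := by linarith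
  field_simp
  linear_combination (s + 1) * h

theorem tiltRoot_sq_lt {s : ℝ} (hs : 1 < s) : tiltRoot s ^ 2 < 2 := by
  have h := tiltRoot_eq hs
  have h0 := tiltRoot_pos hs
  have h1 : 0 < s * (2 - tiltRoot s ^ 2) := h ▸ by positivity
  linarith [pos_of_mul_pos_right h1 (by linarith)]

theorem tiltRoot_strictMono {s t : ℝ} (hs : 1 < s) (hst : s < t) : tiltRoot s < tiltRoot t := by
  by_contra! h
  have hs0 := tiltRoot_pos hs
  have ht0 := tiltRoot_pos (hs.trans hst)
  have h1 := tiltRoot_eq hs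
  have h2 := tiltRoot_eq (hs.trans hst)
  have h3 := tiltRoot_sq_lt hs
  have h4 : (tiltRoot t + 1) * (tiltRoot t + 2) ≤ (tiltRoot s + 1) * (tiltRoot s + 2) := by
    nlinarith
  have h5 : tiltRoot t ^ 2 ≤ tiltRoot s ^ 2 := by nlinarith
  rw [h1, h2] at h4
  nlinarith

theorem tiltRoot_six : tiltRoot 6 = 1 := by
  have : √(8 * 6 ^ 2 + 1 : ℝ) = 17 := by
    rw [show (8 * 6 ^ 2 + 1 : ℝ) = 17 ^ 2 by norm_num, Real.sqrt_sq (by norm_num)]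
  rw [tiltRoot, this]; norm_num

theorem log_tiltRate {x : ℝ} (hx : 0 < x) :
    Real.log (tiltRate x) = Real.log 6 + Real.log x - Real.log (x + 1) - Real.log (x + 2) := by
  rw [tiltRate, Real.log_div (by positivity) (by positivity), Real.log_mul (by positivity)
    (by positivity), Real.log_mul (by positivity) (by positivity)]
  ring

/-- Strict Jensen inequality for log at the points x/y and 1 with weights y/(y + c) and c/(y + c).
-/
theorem mul_log_div_lt_log_add_div {x y c : ℝ} (hx : 0 < x) (hy : 0 < y) (hc : 0 < c)
    (hxy : x ≠ y) : y / (y + c) * Real.log (x / y) < Real.log ((x + c) / (y + c)) := by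
  have h := strictConcaveOn_log_Ioi.2 (show x / y ∈ Set.Ioi 0 from div_pos hx hy)
    (Set.mem_Ioi.2 one_pos) (by rwa [Ne, div_eq_one_iff_eq hy.ne'])
    (show 0 < y / (y + c) by positivity) (show 0 < c / (y + c) by positivity)
    (by field_simp)
  simp only [smul_eq_mul, Real.log_one, mul_zero, add_zero, mul_one] at h
  have e : y / (y + c) * (x / y) + c / (y + c) = (x + c) / (y + c) := by field_simp
  rwa [e] at h

/-- Global maximality without second derivatives: the Jensen inequalities for c = 1 and c = 2 are
added, and the critical-point equation makes the remaining coefficient of log(x/y) vanish. -/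
theorem tiltExponent_lt {s x : ℝ} (hs : 1 < s) (hx : 0 < x) (hne : x ≠ tiltRoot s) :
    tiltExponent s x < tiltExponent s (tiltRoot s) := by
  have hy := tiltRoot_pos hs
  have he := tiltRoot_eq hs
  set y := tiltRoot s
  have h1 := mul_log_div_lt_log_add_div hx hy one_pos hne
  have h2 := mul_log_div_lt_log_add_div hx hy two_pos hne
  have e : s * (1 - y / (y + 1) - y / (y + 2)) = 1 := by
    field_simp
    linear_combination -he
  rw [Real.log_div (by positivity) (by positivity), Real.log_div (by positivity) (by positivity)]
    at h1 h2
  unfold tiltExponent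
  rw [log_tiltRate hx, log_tiltRate hy]
  have h3 := mul_lt_mul_of_pos_left (add_lt_add h1 h2) (show 0 < s by linarith)
  linear_combination h3 + (Real.log x - Real.log y) * e

theorem tiltExponent_le {s x : ℝ} (hs : 1 < s) (hx : 0 < x) :
    tiltExponent s x ≤ tiltExponent s (tiltRoot s) := by
  by_cases h : x = tiltRoot s
  · rw [h]
  · exact (tiltExponent_lt hs hx h).le

theorem tiltExponent_one {x : ℝ} (hx : 0 < x) :
    tiltExponent 1 x = Real.log 6 - Real.log (x + 1) - Real.log (x + 2) := by
  rw [tiltExponent, log_tiltRate hx]; ring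

theorem log_three_eq : Real.log 3 = Real.log 6 - Real.log (0 + 1) - Real.log (0 + 2) := by
  rw [show (6 : ℝ) = 3 * 2 by norm_num, Real.log_mul (by norm_num) (by norm_num)]
  simp

theorem tiltExponent_one_lt {x : ℝ} (hx : 0 < x) : tiltExponent 1 x < Real.log 3 := by
  rw [tiltExponent_one hx, log_three_eq]
  have h1 : Real.log (0 + 1) < Real.log (x + 1) := Real.log_lt_log (by norm_num) (by linarith)
  have h2 : Real.log (0 + 2) < Real.log (x + 2) := Real.log_lt_log (by norm_num) (by linarith)
  linarith

/-- At s = 1 the log x terms cancel, and the supremum log 3 is only approached as x → 0. This is why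
s = 1 is treated separately throughout. -/
theorem tendsto_tiltExponent_one :
    Tendsto (tiltExponent 1) (𝓝[>] 0) (𝓝 (Real.log 3)) := by
  have h : ContinuousAt
      (fun x : ℝ => Real.log 6 - Real.log (x + 1) - Real.log (x + 2)) 0 := by
    refine ContinuousAt.sub (ContinuousAt.sub continuousAt_const ?_) ?_
    · exact ContinuousAt.log (by fun_prop) (by norm_num)
    · exact ContinuousAt.log (by fun_prop) (by norm_num)
  have h' := h.tendsto.mono_left (nhdsWithin_le_nhds (s := Set.Ioi 0))
  rw [← log_three_eq] at h'
  refine h'.congr' ?_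
  filter_upwards [self_mem_nhdsWithin] with x hx
  exact (tiltExponent_one hx).symm

/-- The closed form of the rate function. -/
noncomputable def rate (s : ℝ) : ℝ :=
  if s = 1 then Real.log 3 else tiltExponent s (tiltRoot s)

theorem rate_of_one_lt {s : ℝ} (hs : 1 < s) : rate s = tiltExponent s (tiltRoot s) :=
  if_neg hs.ne'

theorem tiltExponent_le_rate {s x : ℝ} (hs : 1 ≤ s) (hx : 0 < x) : tiltExponent s x ≤ rate s := by
  rcases hs.eq_or_lt with rfl | h
  · rw [rate, if_pos rfl]; exact (tiltExponent_one_lt hx).le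
  · rw [rate_of_one_lt h]; exact tiltExponent_le h hx

/-! ### The function `phi` in terms of `tiltRate` -/

theorem three_add_two_sqrt_two : (√2 + 1) * (√2 + 2) = √2 * (3 + 2 * √2) := by
  have := Real.sq_sqrt (show (0 : ℝ) ≤ 2 by norm_num)
  linear_combination -this

theorem tiltRate_sqrt_two : tiltRate √2 = 6 / (3 + 2 * √2) := by
  rw [tiltRate, three_add_two_sqrt_two]
  have : (0 : ℝ) < √2 := by positivity
  field_simp

theorem six_mul_inv_tiltRate {x : ℝ} (hx : 0 < x) : 6 * (tiltRate x)⁻¹ - 3 = x + 2 / x := by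
  unfold tiltRate
  field_simp
  ring

/-- With r = `tiltRate x`, the numbers x and 2/x are the roots of z^2 - (6/r - 3) z + 2, and `phi`
selects the smaller one, which is x exactly when x^2 ≤ 2. -/
theorem phi_log_tiltRate {x : ℝ} (hx : 0 < x) (hx2 : x ^ 2 ≤ 2) :
    phi (Real.log (tiltRate x)) = ENNReal.ofReal x := by
  have hr := tiltRate_pos hx
  have h2 : (0 : ℝ) < √2 := by positivity
  have hs2 := Real.sq_sqrt (show (0 : ℝ) ≤ 2 by norm_num)
  have hxs : x ≤ √2 := Real.le_sqrt_of_sq_le hx2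
  have hle : tiltRate x ≤ 6 / (3 + 2 * √2) := by
    rw [← tiltRate_sqrt_two, tiltRate, tiltRate, div_le_div_iff₀ (by positivity) (by positivity)]
    have : x * √2 ≤ 2 := by nlinarith
    nlinarith [mul_nonneg (sub_nonneg.2 hxs) (sub_nonneg.2 this)]
  rw [phi, if_neg (not_lt.2 (Real.log_le_log hr hle)), Real.exp_neg, Real.exp_log hr,
    six_mul_inv_tiltRate hx]
  have e : (x + 2 / x) ^ 2 - 8 = (2 / x - x) ^ 2 := by field_simp; ring
  have h3 : 0 ≤ 2 / x - x := by
    rw [sub_nonneg, le_div_iff₀ hx]; nlinarith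
  rw [e, Real.sqrt_sq h3]
  congr 1
  ring

theorem exists_tiltRate_eq {l : ℝ} (hl : l ≤ Real.log (6 / (3 + 2 * √2))) :
    ∃ x, 0 < x ∧ x ^ 2 ≤ 2 ∧ Real.log (tiltRate x) = l := by
  have h2 : (0 : ℝ) < √2 := by positivity
  have hs2 := Real.sq_sqrt (show (0 : ℝ) ≤ 2 by norm_num)
  have hl' : Real.exp l ≤ 6 / (3 + 2 * √2) := by
    rwa [← Real.le_log_iff_exp_le (by positivity)]
  have hu : 2 * √2 ≤ 6 * Real.exp (-l) - 3 := by
    rw [le_div_iff₀ (by positivity)] at hl'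
    have : Real.exp (-l) * Real.exp l = 1 := by rw [← Real.exp_add]; simp
    have h3 := mul_le_mul_of_nonneg_left hl' (Real.exp_pos (-l)).le
    rw [← mul_assoc, this] at h3
    linarith
  set u := 6 * Real.exp (-l) - 3 with hu'
  have hd : 0 ≤ u ^ 2 - 8 := by nlinarith
  have hq := Real.sq_sqrt hd
  have hq0 := Real.sqrt_nonneg (u ^ 2 - 8)
  set q := √(u ^ 2 - 8)
  have hqu : q < u := by nlinarith
  have hx0 : 0 < (u - q) / 2 := by linarith
  have hx : ((u - q) / 2) * ((u + q) / 2) = 2 := by nlinarith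
  refine ⟨(u - q) / 2, hx0, by nlinarith, ?_⟩
  have h4 : 6 * (tiltRate ((u - q) / 2))⁻¹ - 3 = u := by
    rw [six_mul_inv_tiltRate hx0]
    have : 2 / ((u - q) / 2) = (u + q) / 2 := by
      rw [div_eq_iff hx0.ne']; linarith
    rw [this]; ring
  have h5 : (tiltRate ((u - q) / 2))⁻¹ = Real.exp (-l) := by linarith
  rw [← inv_inv (tiltRate _), h5, ← Real.exp_neg, neg_neg, Real.log_exp]

theorem le_PsiExt {s x : ℝ} (hx : 0 < x) (hx2 : x ^ 2 ≤ 2) :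
    ((tiltExponent s x : ℝ) : EReal) ≤ PsiExt s := by
  refine le_trans ?_ (le_iSup _ (Real.log (tiltRate x)))
  rw [phi_log_tiltRate hx hx2, ENNReal.log_ofReal_of_pos hx, ← EReal.coe_sub, tiltExponent,
    mul_comm]

theorem PsiExt_eq_rate {s : ℝ} (hs : 1 ≤ s) : PsiExt s = ((rate s : ℝ) : EReal) := by
  apply le_antisymm
  · refine iSup_le fun l => ?_
    by_cases hl : Real.log (6 / (3 + 2 * √2)) < l
    -- Here `phi l` is infinite, so the term of the supremum is ⊥.
    · rw [phi, if_pos hl]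
      simp
    · obtain ⟨x, hx, hx2, rfl⟩ := exists_tiltRate_eq (not_lt.1 hl)
      rw [phi_log_tiltRate hx hx2, ENNReal.log_ofReal_of_pos hx, ← EReal.coe_sub, EReal.coe_le_coe_iff,
        mul_comm]
      exact tiltExponent_le_rate hs hx
  · rcases hs.eq_or_lt with rfl | h
    · rw [rate, if_pos rfl]
      refine le_of_tendsto ((continuous_coe_real_ereal.tendsto _).comp tendsto_tiltExponent_one) ?_
      filter_upwards [Ioo_mem_nhdsGT (show (0 : ℝ) < 1 by norm_num)] with x hx
      exact le_PsiExt hx.1 (by nlinarith [hx.1, hx.2])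
    · rw [rate_of_one_lt h]
      exact le_PsiExt (tiltRoot_pos h) (tiltRoot_sq_lt h).le

theorem Psi_eq_rate {s : ℝ} (hs : 1 ≤ s) : Psi s = rate s := by
  rw [Psi, PsiExt_eq_rate hs, EReal.toReal_coe]

/-! ### Regularity of the rate function -/

theorem hasDerivAt_log_tiltRate {x : ℝ} (hx : 0 < x) :
    HasDerivAt (fun y => Real.log (tiltRate y)) ((2 - x ^ 2) / (x * (x + 1) * (x + 2))) x := by
  have h : HasDerivAt (fun y => Real.log 6 + Real.log y - Real.log (y + 1) - Real.log (y + 2))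
      (1 / x - 1 / (x + 1) - 1 / (x + 2)) x := by
    have h1 := (hasDerivAt_id x).log hx.ne'
    have h2 := ((hasDerivAt_id x).add_const 1).log (show id x + 1 ≠ 0 by simp; positivity)
    have h3 := ((hasDerivAt_id x).add_const 2).log (show id x + 2 ≠ 0 by simp; positivity)
    exact ((h1.const_add (Real.log 6)).sub h2).sub h3
  have e : 1 / x - 1 / (x + 1) - 1 / (x + 2) = (2 - x ^ 2) / (x * (x + 1) * (x + 2)) := by
    field_simp; ring
  rw [← e]
  refine h.congr_of_eventuallyEq ?_
  filter_upwards [lt_mem_nhds hx] with y hy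
  exact log_tiltRate hy

theorem hasDerivAt_tiltRoot {s : ℝ} (hs : 1 < s) :
    HasDerivAt tiltRoot ((8 * s * (s + 1) / √(8 * s ^ 2 + 1) - (√(8 * s ^ 2 + 1) - 3))
      / (2 * (s + 1) ^ 2)) s := by
  have hpos : 8 * s ^ 2 + 1 ≠ 0 := by positivity
  have h1 : HasDerivAt (fun s : ℝ => 8 * s ^ 2 + 1) (8 * (2 * s)) s := by
    simpa using ((hasDerivAt_pow 2 s).const_mul 8).add_const 1
  have h2 := (h1.sqrt hpos).sub_const 3
  have h3 : HasDerivAt (fun s : ℝ => 2 * (s + 1)) 2 s := by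
    simpa using ((hasDerivAt_id s).add_const 1).const_mul 2
  have hs1 : s + 1 ≠ 0 := by linarith
  have h4 := h2.div h3 (by positivity)
  refine h4.congr_deriv ?_
  have : √(8 * s ^ 2 + 1) ≠ 0 := by positivity
  field_simp

theorem hasDerivAt_rate {s : ℝ} (hs : 1 < s) :
    HasDerivAt rate (Real.log (tiltRate (tiltRoot s))) s := by
  have hx := tiltRoot_pos hs
  have h1 := hasDerivAt_tiltRoot hs
  have h2 := (hasDerivAt_log_tiltRate hx).comp s h1
  have h3 := ((hasDerivAt_id s).mul h2).sub (h1.log hx.ne')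
  have h4 := h3.congr_of_eventuallyEq (f₁ := rate) (by
    filter_upwards [lt_mem_nhds hs] with t ht
    rw [rate_of_one_lt ht]; rfl)
  refine h4.congr_deriv ?_
  have he := tiltRoot_eq hs
  simp only [id, Function.comp]
  set x := tiltRoot s
  -- Envelope principle: the derivative d of the maximiser enters with coefficient zero by the
  -- critical-point equation, so its value is irrelevant.
  generalize (8 * s * (s + 1) / √(8 * s ^ 2 + 1) - (√(8 * s ^ 2 + 1) - 3))
      / (2 * (s + 1) ^ 2) = d
  have : s * ((2 - x ^ 2) / (x * (x + 1) * (x + 2)) * d) = d / x := by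
    field_simp
    linear_combination -d * he
  rw [this]
  ring

theorem Psi_eventuallyEq_rate {s : ℝ} (hs : 1 < s) : Psi =ᶠ[𝓝 s] rate := by
  filter_upwards [lt_mem_nhds hs] with t ht
  exact Psi_eq_rate ht.le

theorem hasDerivAt_Psi {s : ℝ} (hs : 1 < s) :
    HasDerivAt Psi (Real.log (tiltRate (tiltRoot s))) s :=
  (hasDerivAt_rate hs).congr_of_eventuallyEq (Psi_eventuallyEq_rate hs)

theorem tiltRate_one : tiltRate 1 = 1 := by norm_num [tiltRate]

theorem Psi_six : Psi 6 = 0 := by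
  rw [Psi_eq_rate (by norm_num), rate_of_one_lt (by norm_num), tiltRoot_six, tiltExponent,
    tiltRate_one]
  simp

theorem exists_hasDerivAt_deriv_Psi : ∃ c : ℝ, 0 < c ∧ HasDerivAt (deriv Psi) c 6 := by
  have h6 : (1 : ℝ) < 6 := by norm_num
  have h1 := (hasDerivAt_log_tiltRate (tiltRoot_pos h6)).comp 6 (hasDerivAt_tiltRoot h6)
  refine ⟨_, ?_, h1.congr_of_eventuallyEq ?_⟩
  -- The second derivative is (1/6)(1/17): the derivative of log r at x = 1 times that of `tiltRoot`
  -- at 6.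
  · have : √(8 * 6 ^ 2 + 1 : ℝ) = 17 := by
      rw [show (8 * 6 ^ 2 + 1 : ℝ) = 17 ^ 2 by norm_num, Real.sqrt_sq (by norm_num)]
    rw [tiltRoot_six, this]
    norm_num
  · filter_upwards [lt_mem_nhds h6] with t ht
    exact (hasDerivAt_Psi ht).deriv

/-! ### Upper bounds -/

theorem tiltRate_lt_tiltRate {x y : ℝ} (hx : 0 < x) (hxy : x < y) (h : x * y < 2) :
    tiltRate x < tiltRate y := by
  have hy := hx.trans hxy
  rw [tiltRate, tiltRate, div_lt_div_iff₀ (by positivity) (by positivity)]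
  nlinarith [mul_pos (sub_pos.2 hxy) (sub_pos.2 h)]

theorem tiltRate_le_two {x : ℝ} (hx : 0 < x) : tiltRate x ≤ 2 := by
  rw [tiltRate, div_le_iff₀ (by positivity)]
  nlinarith

theorem tiltRate_le_one {x : ℝ} (hx : 0 < x) (hx1 : x ≤ 1) : tiltRate x ≤ 1 := by
  rw [tiltRate, div_le_iff₀ (by positivity)]
  nlinarith

theorem one_le_tiltRate {x : ℝ} (hx1 : 1 ≤ x) (hx2 : x ^ 2 < 2) : 1 ≤ tiltRate x := by
  rw [tiltRate, le_div_iff₀ (by positivity)]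
  nlinarith

theorem tiltRate_tiltRoot_lt {s t : ℝ} (hs : 1 < s) (hst : s < t) :
    tiltRate (tiltRoot s) < tiltRate (tiltRoot t) := by
  have h1 := tiltRoot_strictMono hs hst
  have h2 := tiltRoot_pos hs
  have h3 := tiltRoot_sq_lt (hs.trans hst)
  exact tiltRate_lt_tiltRate h2 h1 (by nlinarith)

theorem pow_eq_exp_mul_log {x : ℝ} (hx : 0 < x) (n : ℕ) : x ^ n = Real.exp (n * Real.log x) := by
  rw [Real.exp_nat_mul, Real.exp_log hx]

/-- Chernoff bound for the lower tail: x ≤ 1 gives r ≤ 1, so r^j ≥ r^m for j ≤ m. Keeping x free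
allows the limit x → 0 needed at s = 1. -/
theorem sum_hitLaw_le {N : ℕ} (hN : 1 ≤ N) {s x : ℝ} (hs : 0 ≤ s) (hx : 0 < x) (hx1 : x ≤ 1) :
    ∑ j ∈ Finset.range (⌊s * N⌋₊ + 1), hitLaw N j
      ≤ 2 * Real.exp (-(N * tiltExponent s x)) := by
  set m := ⌊s * N⌋₊
  have hr := tiltRate_pos hx
  have hr1 := tiltRate_le_one hx hx1
  have h := sum_hitLaw_mul_pow_le hN hx (by nlinarith) m
  have h1 : (∑ j ∈ Finset.range (m + 1), hitLaw N j) * tiltRate x ^ m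
      ≤ ∑ j ∈ Finset.range (m + 1), hitLaw N j * tiltRate x ^ j := by
    rw [Finset.sum_mul]
    refine Finset.sum_le_sum fun j hj => mul_le_mul_of_nonneg_left ?_ (hitLaw_nonneg _ _)
    exact pow_le_pow_of_le_one hr.le hr1 (by simpa [Nat.lt_succ_iff] using hj)
  have h2 := h1.trans h
  rw [← le_div_iff₀ (by positivity)] at h2
  refine h2.trans ?_
  rw [mul_div_assoc, pow_eq_exp_mul_log hx, pow_eq_exp_mul_log hr, ← Real.exp_sub]
  refine mul_le_mul_of_nonneg_left (Real.exp_le_exp.2 ?_) two_pos.le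
  have h3 : (m : ℝ) ≤ s * N := Nat.floor_le (by positivity)
  have h4 := mul_le_mul_of_nonpos_right h3 (Real.log_nonpos hr.le hr1)
  unfold tiltExponent
  linarith

theorem sum_hitLaw_le_rate {N : ℕ} (hN : 1 ≤ N) {s : ℝ} (hs : 1 ≤ s) (hs6 : s ≤ 6) :
    ∑ j ∈ Finset.range (⌊s * N⌋₊ + 1), hitLaw N j ≤ 2 * Real.exp (-(N * rate s)) := by
  rcases hs.eq_or_lt with rfl | h
  · have hc : ContinuousAt (fun y : ℝ => 2 * Real.exp (-(N * y))) (rate 1) := by fun_prop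
    have ht := hc.tendsto
    nth_rewrite 1 [rate, if_pos rfl] at ht
    refine ge_of_tendsto (ht.comp tendsto_tiltExponent_one) ?_
    filter_upwards [Ioo_mem_nhdsGT (show (0 : ℝ) < 1 by norm_num)] with x hx
    exact sum_hitLaw_le hN zero_le_one hx.1 hx.2.le
  · rw [rate_of_one_lt h]
    refine sum_hitLaw_le hN (by linarith) (tiltRoot_pos h) ?_
    rcases hs6.eq_or_lt with rfl | h6
    · exact tiltRoot_six.le
    · exact (tiltRoot_strictMono h h6).le.trans tiltRoot_six.le

theorem sum_killedLaw_le {N : ℕ} (hN : 1 ≤ N) {s : ℝ} (hs : 6 ≤ s) :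
    ∑ k ∈ Finset.range N, killedLaw N (⌊s * N⌋₊ - 1) k ≤ 8 * Real.exp (-(N * rate s)) := by
  have h1s : 1 < s := by linarith
  set m := ⌊s * N⌋₊ - 1 with hm
  have hx1 : 1 ≤ tiltRoot s := by
    rcases hs.eq_or_lt with rfl | h6
    · exact tiltRoot_six.ge
    · exact tiltRoot_six.ge.trans (tiltRoot_strictMono (by norm_num) h6).le
  have hx := tiltRoot_pos h1s
  have hx2 := tiltRoot_sq_lt h1s
  rw [rate_of_one_lt h1s]
  set x := tiltRoot s
  have hr := tiltRate_pos hx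
  have hr1 := one_le_tiltRate hx1 hx2
  have h := sum_killedLaw_mul_inv_pow_le hN hx hx2 m
  have h1 : (∑ k ∈ Finset.range N, killedLaw N m k) * (x⁻¹) ^ N
      ≤ ∑ k ∈ Finset.range N, killedLaw N m k * (x⁻¹) ^ k := by
    rw [Finset.sum_mul]
    refine Finset.sum_le_sum fun k hk => mul_le_mul_of_nonneg_left ?_ (killedLaw_nonneg _ _ _)
    exact pow_le_pow_of_le_one (by positivity) (inv_le_one_of_one_le₀ hx1)
      (Finset.mem_range.1 hk).le
  have h2 := (mul_le_mul_of_nonneg_right h1 (pow_nonneg hr.le m)).trans h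
  rw [inv_pow, ← div_eq_mul_inv, ← le_div_iff₀ (by positivity), div_le_iff₀ (by positivity)] at h2
  refine h2.trans ?_
  -- The floor and the shift by one lose at most two time units, hence a factor r^2 ≤ 4, which turns
  -- the constant 2 into 8.
  have h3 : s * N - 2 ≤ m := by
    have := Nat.lt_floor_add_one (s * N)
    have h4 : (⌊s * N⌋₊ : ℝ) ≤ m + 1 := by exact_mod_cast (by omega : ⌊s * N⌋₊ ≤ m + 1)
    linarith
  have h5 : Real.exp (2 * Real.log (tiltRate x)) ≤ 4 := by
    have : Real.exp (2 * Real.log (tiltRate x)) = tiltRate x ^ 2 := by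
      rw [pow_eq_exp_mul_log hr]; norm_num
    rw [this]
    nlinarith [tiltRate_le_two hx]
  have h6 := mul_le_mul_of_nonneg_right h3 (Real.log_nonneg hr1)
  calc 2 / tiltRate x ^ m * x ^ N
      = 2 * Real.exp (N * Real.log x - m * Real.log (tiltRate x)) := by
        rw [Real.exp_sub, pow_eq_exp_mul_log hx, pow_eq_exp_mul_log hr]; ring
    _ ≤ 2 * Real.exp (2 * Real.log (tiltRate x) + -(N * tiltExponent s x)) := by
        refine mul_le_mul_of_nonneg_left (Real.exp_le_exp.2 ?_) two_pos.le
        unfold tiltExponent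
        linarith
    _ ≤ 8 * Real.exp (-(N * tiltExponent s x)) := by
        rw [Real.exp_add]
        nlinarith [Real.exp_pos (-(N * tiltExponent s x))]

/-! ### Lower bounds -/

theorem eventually_mul_exp_neg_le {C η c : ℝ} (hη : 0 < η) (hc : 0 < c) :
    ∀ᶠ N : ℕ in atTop, C * Real.exp (-(N * η)) ≤ c := by
  have h1 : Tendsto (fun N : ℕ => (N : ℝ) * η) atTop atTop :=
    tendsto_natCast_atTop_atTop.atTop_mul_const hη
  have h2 := (Real.tendsto_exp_neg_atTop_nhds_zero.comp h1).const_mul C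
  rw [mul_zero] at h2
  exact (h2.eventually_lt_const hc).mono fun N h => h.le

/-- The part of the martingale identity carried by the paths which have not reached `N`. -/
theorem sum_killedLaw_mul_tiltFun_le {N : ℕ} (hN : 1 ≤ N) {s x y : ℝ} (hx : 0 < x)
    (hxy : x < y) (hy2 : y ^ 2 < 2) :
    (∑ k ∈ Finset.range N, killedLaw N ⌊s * N⌋₊ k * tiltFun x k) * tiltRate x ^ ⌊s * N⌋₊
      ≤ 4 * (tiltRate y / tiltRate x)
        * Real.exp (-(N * (tiltExponent s y - tiltExponent s x))) := by
  set m := ⌊s * N⌋₊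
  have hy := hx.trans hxy
  have hrx := tiltRate_pos hx
  have hry := tiltRate_pos hy
  have hr : tiltRate x < tiltRate y := tiltRate_lt_tiltRate hx hxy (by nlinarith)
  have h1 : ∑ k ∈ Finset.range N, killedLaw N m k * tiltFun x k
      ≤ 2 * (y / x) ^ N * ∑ k ∈ Finset.range N, killedLaw N m k * (y⁻¹) ^ k := by
    rw [Finset.mul_sum]
    refine Finset.sum_le_sum fun k hk => ?_
    rw [mul_left_comm]
    refine mul_le_mul_of_nonneg_left ?_ (killedLaw_nonneg _ _ _)
    refine (tiltFun_le hx (by nlinarith) k).trans ?_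
    rw [mul_assoc]
    refine mul_le_mul_of_nonneg_left ?_ two_pos.le
    -- Change of tilt from x to y > x; as k < N, the density (y/x)^k is at most (y/x)^N.
    have e : (x⁻¹) ^ k = (y / x) ^ k * (y⁻¹) ^ k := by
      rw [← mul_pow]; congr 1; field_simp
    rw [e]
    refine mul_le_mul_of_nonneg_right ?_ (by positivity)
    exact pow_le_pow_right₀ ((one_le_div hx).2 hxy.le) (Finset.mem_range.1 hk).le
  have h2 := sum_killedLaw_mul_inv_pow_le hN hy hy2 m
  rw [← le_div_iff₀ (by positivity)] at h2
  have h3 : s * N - 1 ≤ m := by linarith [Nat.lt_floor_add_one (s * N)]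
  have h4 := mul_le_mul_of_nonneg_right h3 (sub_nonneg.2 (Real.log_le_log hrx hr.le))
  calc (∑ k ∈ Finset.range N, killedLaw N m k * tiltFun x k) * tiltRate x ^ m
      ≤ 2 * (y / x) ^ N * (2 / tiltRate y ^ m) * tiltRate x ^ m := by
        refine mul_le_mul_of_nonneg_right (h1.trans ?_) (by positivity)
        exact mul_le_mul_of_nonneg_left h2 (by positivity)
    _ = 4 * Real.exp (N * Real.log y - N * Real.log x - m * Real.log (tiltRate y)
          + m * Real.log (tiltRate x)) := by
        rw [Real.exp_add, Real.exp_sub, Real.exp_sub, ← pow_eq_exp_mul_log hx,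
          ← pow_eq_exp_mul_log hy, ← pow_eq_exp_mul_log hrx, ← pow_eq_exp_mul_log hry, div_pow]
        ring
    _ ≤ 4 * Real.exp (Real.log (tiltRate y) - Real.log (tiltRate x)
          + -(N * (tiltExponent s y - tiltExponent s x))) := by
        refine mul_le_mul_of_nonneg_left (Real.exp_le_exp.2 ?_) (by norm_num)
        unfold tiltExponent
        linarith
    _ = _ := by
        rw [Real.exp_add, Real.exp_sub, Real.exp_log hrx, Real.exp_log hry, mul_assoc]

/-- The part of the martingale identity carried by the paths which reach `N` early. -/
theorem tiltFun_mul_sum_hitLaw_le {N : ℕ} (hN : 1 ≤ N) {s x y : ℝ} (hs : 0 ≤ s) (hy : 0 < y)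
    (hyx : y < x) (hx2 : x ^ 2 < 2) :
    tiltFun x N * ∑ j ∈ Finset.range (⌊s * N⌋₊ + 1), hitLaw N j * tiltRate x ^ j
      ≤ 4 * Real.exp (-(N * (tiltExponent s y - tiltExponent s x))) := by
  set m := ⌊s * N⌋₊
  have hx := hy.trans hyx
  have hrx := tiltRate_pos hx
  have hry := tiltRate_pos hy
  have hr : tiltRate y < tiltRate x := tiltRate_lt_tiltRate hy hyx (by nlinarith)
  have h1 : ∑ j ∈ Finset.range (m + 1), hitLaw N j * tiltRate x ^ j
      ≤ (tiltRate x / tiltRate y) ^ m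
        * ∑ j ∈ Finset.range (m + 1), hitLaw N j * tiltRate y ^ j := by
    rw [Finset.mul_sum]
    refine Finset.sum_le_sum fun j hj => ?_
    rw [mul_left_comm]
    refine mul_le_mul_of_nonneg_left ?_ (hitLaw_nonneg _ _)
    -- Change of tilt from x down to y; the ratio of rates exceeds 1, so its power is largest at j =
    -- m.
    have e : tiltRate x ^ j = (tiltRate x / tiltRate y) ^ j * tiltRate y ^ j := by
      rw [← mul_pow]; congr 1; field_simp
    rw [e]
    refine mul_le_mul_of_nonneg_right ?_ (by positivity)
    exact pow_le_pow_right₀ ((one_le_div hry).2 hr.le) (by simpa [Nat.lt_succ_iff] using hj)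
  have h2 := sum_hitLaw_mul_pow_le hN hy (by nlinarith) m
  have h3 : (m : ℝ) ≤ s * N := Nat.floor_le (by positivity)
  have h4 := mul_le_mul_of_nonneg_right h3 (sub_nonneg.2 (Real.log_le_log hry hr.le))
  calc tiltFun x N * ∑ j ∈ Finset.range (m + 1), hitLaw N j * tiltRate x ^ j
      ≤ (2 * (x⁻¹) ^ N) * ((tiltRate x / tiltRate y) ^ m * (2 * y ^ N)) := by
        refine mul_le_mul (tiltFun_le hx hx2 N) (h1.trans ?_) ?_ (by positivity)
        · exact mul_le_mul_of_nonneg_left h2 (by positivity)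
        · exact Finset.sum_nonneg fun j _ => mul_nonneg (hitLaw_nonneg _ _) (by positivity)
    _ = 4 * Real.exp (N * Real.log y - N * Real.log x - m * Real.log (tiltRate y)
          + m * Real.log (tiltRate x)) := by
        rw [Real.exp_add, Real.exp_sub, Real.exp_sub, ← pow_eq_exp_mul_log hx,
          ← pow_eq_exp_mul_log hy, ← pow_eq_exp_mul_log hrx, ← pow_eq_exp_mul_log hry, div_pow]
        ring
    _ ≤ _ := by
        refine mul_le_mul_of_nonneg_left (Real.exp_le_exp.2 ?_) (by norm_num)
        unfold tiltExponent
        linarith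

/-- Waiting moves the mass from time j to time m. The bound R ≥ 1 lets the exponent m - j be raised
to m - l, uniformly in j. -/
theorem hitLaw_mul_pow_le {N : ℕ} (hN : 1 ≤ N) {r R : ℝ} (hr : 0 < r) (hR : 1 ≤ R)
    (hrR : 1 / r ≤ R) {l m j : ℕ} (hlj : l ≤ j) (hjm : j ≤ m) :
    hitLaw N j * r ^ j ≤ (3 / 2 * R) ^ (m - l) * (hitLaw N m * r ^ m) := by
  obtain ⟨k, rfl⟩ := Nat.exists_eq_add_of_le hjm
  have h1 := hitLaw_add_ge hN j k
  have h2 : (3 / 2 * (1 / r)) ^ k ≤ (3 / 2 * R) ^ (j + k - l) :=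
    (pow_le_pow_left₀ (by positivity) (by linarith) k).trans
      (pow_le_pow_right₀ (by linarith) (by omega))
  have h3 : 0 ≤ hitLaw N (j + k) * r ^ (j + k) := mul_nonneg (hitLaw_nonneg _ _) (by positivity)
  refine le_trans ?_ (mul_le_mul_of_nonneg_right h2 h3)
  calc hitLaw N j * r ^ j
      = (3 / 2 * (1 / r)) ^ k * (((2 / 3) ^ k * hitLaw N j) * r ^ (j + k)) := by
        have e : (3 / 2 * (1 / r)) ^ k * (2 / 3) ^ k * r ^ k = 1 := by
          rw [← mul_pow, ← mul_pow]
          rw [show 3 / 2 * (1 / r) * (2 / 3) * r = 1 by field_simp, one_pow]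
        rw [pow_add]
        linear_combination -(hitLaw N j * r ^ j) * e
    _ ≤ _ := mul_le_mul_of_nonneg_left
        (mul_le_mul_of_nonneg_right h1 (by positivity)) (by positivity)

theorem sum_Ico_hitLaw_mul_pow_le {N : ℕ} (hN : 1 ≤ N) {r R : ℝ} (hr : 0 < r) (hR : 1 ≤ R)
    (hrR : 1 / r ≤ R) (l m : ℕ) :
    ∑ j ∈ Finset.Ico (l + 1) (m + 1), hitLaw N j * r ^ j
      ≤ (3 * R) ^ (m - l) * (hitLaw N m * r ^ m) := by
  have h1 := Finset.sum_le_card_nsmul (Finset.Ico (l + 1) (m + 1)) (fun j => hitLaw N j * r ^ j)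
    ((3 / 2 * R) ^ (m - l) * (hitLaw N m * r ^ m)) fun j hj => by
      rw [Finset.mem_Ico] at hj
      exact hitLaw_mul_pow_le hN hr hR hrR (by omega) (by omega)
  refine h1.trans ?_
  have h3 : 0 ≤ hitLaw N m * r ^ m := mul_nonneg (hitLaw_nonneg _ _) (by positivity)
  rw [Nat.card_Ico, nsmul_eq_mul, Nat.add_sub_add_right, ← mul_assoc]
  refine mul_le_mul_of_nonneg_right ?_ h3
  rw [show 3 * R = 2 * (3 / 2 * R) by ring, mul_pow 2]
  refine mul_le_mul_of_nonneg_right ?_ (by positivity)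
  -- The number m - l of terms is absorbed by doubling the base 3R/2.
  exact_mod_cast (Nat.lt_two_pow_self (n := m - l)).le

theorem eventually_exp_le_hitLaw_of_one_lt {s ε : ℝ} (hs : 1 < s) (hε : 0 < ε) :
    ∀ᶠ N : ℕ in atTop, Real.exp (-(N * (rate s + ε))) ≤ hitLaw N ⌊s * N⌋₊ := by
  -- A fixed point below the window, so that R and the waiting cost D are chosen before u; later t >
  -- σ ensures 1/r ≤ R.
  set σ := (1 + s) / 2 with hσ
  set R := max 1 (1 / tiltRate (tiltRoot σ)) with hR
  have hR1 : 1 ≤ R := le_max_left _ _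
  set D := Real.log (3 * R) with hD
  have hD0 : 0 < D := Real.log_pos (by linarith)
  -- The window (u, s) is so narrow that moving mass across it costs at most ε/2 in the exponent.
  set u := max σ (s - ε / (2 * D)) with hu
  have hus : u < s := max_lt (by linarith) (by linarith [show 0 < ε / (2 * D) by positivity])
  have huσ : σ ≤ u := le_max_left _ _
  have hu1 : 1 < u := by linarith
  have huD : (s - u) * D ≤ ε / 2 := by
    have h1 : s - u ≤ ε / (2 * D) := by linarith [le_max_right σ (s - ε / (2 * D))]
    calc (s - u) * D ≤ ε / (2 * D) * D := mul_le_mul_of_nonneg_right h1 hD0.le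
      _ = ε / 2 := by field_simp
  set t := (u + s) / 2 with ht
  have hut : u < t := by linarith
  have hts : t < s := by linarith
  have ht1 : 1 < t := by linarith
  have hy := tiltRoot_pos hu1
  have hx := tiltRoot_pos ht1
  have hyx := tiltRoot_strictMono hu1 hut
  have hxz := tiltRoot_strictMono ht1 hts
  have hx2 := tiltRoot_sq_lt ht1
  have hz2 := tiltRoot_sq_lt hs
  have hη1 : 0 < tiltExponent s (tiltRoot s) - tiltExponent s (tiltRoot t) :=
    sub_pos.2 (tiltExponent_lt hs hx hxz.ne)
  have hη2 : 0 < tiltExponent u (tiltRoot u) - tiltExponent u (tiltRoot t) :=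
    sub_pos.2 (tiltExponent_lt hu1 hx hyx.ne')
  have hrate := tiltExponent_le_rate hs.le hx
  have hrR : 1 / tiltRate (tiltRoot t) ≤ R := by
    refine le_trans ?_ (le_max_right _ _)
    exact one_div_le_one_div_of_le (tiltRate_pos (tiltRoot_pos (by linarith)))
      (tiltRate_tiltRoot_lt (by linarith) (by linarith)).le
  set x := tiltRoot t
  have hr := tiltRate_pos hx
  -- The martingale identity has total 4c; the early and late paths will each take at most c,
  -- leaving 2c for the window.
  set c := (2 - x ^ 2) / 4 with hc
  have hc0 : 0 < c := by linarith
  set L := |Real.log (tiltRate x)| with hL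
  filter_upwards [eventually_ge_atTop 1, eventually_mul_exp_neg_le (C := 4 * (tiltRate (tiltRoot s)
    / tiltRate x)) hη1 hc0, eventually_mul_exp_neg_le (C := 4) hη2 hc0,
    eventually_mul_exp_neg_le (C := 1) (half_pos hε) (mul_pos hc0 (Real.exp_pos (-(L + D))))]
    with N hN hE1 hE2 hE3
  have h1 := (sum_killedLaw_mul_tiltFun_le (s := s) hN hx hxz hz2).trans hE1
  have h2 := (tiltFun_mul_sum_hitLaw_le (s := u) hN (by linarith) hy hyx hx2).trans hE2
  set m := ⌊s * N⌋₊
  set l := ⌊u * N⌋₊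
  have hlm : l ≤ m := Nat.floor_mono (by gcongr)
  have h3 := tilt_martingale hN hx m
  rw [← Finset.sum_range_add_sum_Ico _ (Nat.succ_le_succ hlm), mul_add] at h3
  have h4 : 2 * c ≤ tiltFun x N * ((3 * R) ^ (m - l) * (hitLaw N m * tiltRate x ^ m)) := by
    have := mul_le_mul_of_nonneg_left (sum_Ico_hitLaw_mul_pow_le hN hr hR1 hrR l m)
      (tiltFun_pos hx hx2 N).le
    simp only [Nat.succ_eq_add_one] at h3
    linarith
  have h5 : 0 ≤ (3 * R) ^ (m - l) * (hitLaw N m * tiltRate x ^ m) :=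
    mul_nonneg (by positivity) (mul_nonneg (hitLaw_nonneg _ _) (by positivity))
  have h6 := h4.trans (mul_le_mul_of_nonneg_right (tiltFun_le hx hx2 N) h5)
  have h7 : c ≤ Real.exp (-(N * Real.log x) + (m - l : ℕ) * D + m * Real.log (tiltRate x))
      * hitLaw N m := by
    rw [Real.exp_add, Real.exp_add, Real.exp_neg, ← pow_eq_exp_mul_log hx, hD,
      ← pow_eq_exp_mul_log (by linarith), ← pow_eq_exp_mul_log hr, ← inv_pow]
    linarith
  have hm1 : s * N - 1 ≤ m := by linarith [Nat.lt_floor_add_one (s * N)]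
  have hm2 : (m : ℝ) ≤ s * N := Nat.floor_le (by positivity)
  have hl1 : u * N - 1 ≤ l := by linarith [Nat.lt_floor_add_one (u * N)]
  have hml : ((m - l : ℕ) : ℝ) * D ≤ N * (ε / 2) + D := by
    rw [Nat.cast_sub hlm]
    have a : ((m : ℝ) - l) * D ≤ ((s - u) * N + 1) * D :=
      mul_le_mul_of_nonneg_right (by linarith) hD0.le
    have b := mul_le_mul_of_nonneg_left huD (Nat.cast_nonneg (α := ℝ) N)
    linarith
  have hmr : m * Real.log (tiltRate x) ≤ s * N * Real.log (tiltRate x) + L := by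
    have a : ((m : ℝ) - s * N) * Real.log (tiltRate x) ≤ |(m : ℝ) - s * N| * L := by
      rw [hL, ← abs_mul]; exact le_abs_self _
    have b : |(m : ℝ) - s * N| ≤ 1 := abs_le.2 ⟨by linarith, by linarith⟩
    have d := mul_le_mul_of_nonneg_right b (abs_nonneg (Real.log (tiltRate x)))
    linarith
  have hrateN := mul_le_mul_of_nonneg_left hrate (Nat.cast_nonneg (α := ℝ) N)
  unfold tiltExponent at hrateN
  have h8 : c ≤ Real.exp (L + D + N * (rate s + ε / 2)) * hitLaw N m := by
    refine h7.trans (mul_le_mul_of_nonneg_right (Real.exp_le_exp.2 ?_) (hitLaw_nonneg _ _))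
    linarith
  calc Real.exp (-(N * (rate s + ε)))
      = Real.exp (-(N * (ε / 2))) * Real.exp (-(N * (rate s + ε / 2))) := by
        rw [← Real.exp_add]; congr 1; ring
    _ ≤ c * Real.exp (-(L + D)) * Real.exp (-(N * (rate s + ε / 2))) :=
        mul_le_mul_of_nonneg_right (by linarith) (Real.exp_pos _).le
    _ = c * Real.exp (-(L + D + N * (rate s + ε / 2))) := by
        rw [mul_assoc, ← Real.exp_add]; congr 2; ring
    _ ≤ hitLaw N m := by
        rw [Real.exp_neg, ← div_eq_mul_inv, div_le_iff₀ (Real.exp_pos _)]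
        linarith

theorem eventually_exp_le_hitLaw {s ε : ℝ} (hs : 1 ≤ s) (hε : 0 < ε) :
    ∀ᶠ N : ℕ in atTop, Real.exp (-(N * (rate s + ε))) ≤ hitLaw N ⌊s * N⌋₊ := by
  rcases hs.eq_or_lt with rfl | h
  · filter_upwards [eventually_ge_atTop 1] with N hN
    rw [one_mul, Nat.floor_natCast]
    refine le_trans ?_ (hitLaw_self_ge hN)
    rw [pow_eq_exp_mul_log (by norm_num), Real.exp_le_exp, rate, if_pos rfl, one_div, Real.log_inv]
    have : (0 : ℝ) ≤ N * ε := by positivity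
    linarith
  · exact eventually_exp_le_hitLaw_of_one_lt h hε

/-! ### Uniformity -/

theorem exists_sub_lt_tiltExponent {s ε : ℝ} (hs : 1 ≤ s) (hε : 0 < ε) :
    ∃ x, 0 < x ∧ rate s - ε < tiltExponent s x := by
  rcases hs.eq_or_lt with rfl | h
  · rw [rate, if_pos rfl]
    obtain ⟨x, h1, h2⟩ := ((tendsto_tiltExponent_one.eventually_const_lt
      (show Real.log 3 - ε < Real.log 3 by linarith)).and self_mem_nhdsWithin).exists
    exact ⟨x, h2, h1⟩
  · exact ⟨_, tiltRoot_pos h, by rw [rate_of_one_lt h]; linarith⟩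

/-- For fixed x the exponent is affine in t; the rate dominates all of these and is nearly attained
at s, hence lower semicontinuous, including at s = 1. -/
theorem eventually_rate_sub_lt {s ε : ℝ} (hs : 1 ≤ s) (hε : 0 < ε) :
    ∀ᶠ t in 𝓝 s, 1 ≤ t → rate s - ε < rate t := by
  obtain ⟨x, hx, h⟩ := exists_sub_lt_tiltExponent hs hε
  have hc : ContinuousAt (fun t => tiltExponent t x) s := by
    unfold tiltExponent; fun_prop
  filter_upwards [hc.eventually_const_lt h] with t ht h1
  exact ht.trans_le (tiltExponent_le_rate h1 hx)

theorem exists_near_rate_le {s ε : ℝ} (hs : 1 ≤ s) (hε : 0 < ε) :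
    ∃ u, 1 ≤ u ∧ u ≤ s ∧ s - u < ε ∧ rate u ≤ rate s + ε ∧ ∀ᶠ t in 𝓝 s, 1 ≤ t → u ≤ t := by
  rcases hs.eq_or_lt with rfl | h
  · exact ⟨1, le_rfl, le_rfl, by linarith, by linarith, Eventually.of_forall fun t => id⟩
  · have h1 := (hasDerivAt_rate h).continuousAt.eventually_lt_const
      (show rate s < rate s + ε by linarith)
    have h2 : ∀ᶠ u in 𝓝[<] s, u ∈ Set.Ioo (max 1 (s - ε)) s :=
      Ioo_mem_nhdsLT (max_lt h (by linarith))
    obtain ⟨u, hu1, hu2⟩ := ((h1.filter_mono nhdsWithin_le_nhds).and h2).exists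
    have h3 := max_lt_iff.1 hu2.1
    refine ⟨u, h3.1.le, hu2.2.le, by linarith, hu1.le, ?_⟩
    filter_upwards [lt_mem_nhds hu2.2] with t ht _
    exact ht.le

theorem eventually_forall_near_exp_le_hitLaw {s ε : ℝ} (hs : 1 ≤ s) (hε : 0 < ε) :
    ∃ U ∈ 𝓝 s, ∀ᶠ N : ℕ in atTop, ∀ t ∈ U, 1 ≤ t →
      Real.exp (-(N * (rate t + ε))) ≤ hitLaw N ⌊t * N⌋₊ := by
  -- Budget in sixths of ε: three for the bound at u and for comparing `rate u` with `rate t`, two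
  -- for waiting over a time (t - u)N, one for the rounding.
  have hε6 : 0 < ε / 6 := by positivity
  obtain ⟨u, hu1, hus, hsu, hrate, hut⟩ := exists_near_rate_le hs hε6
  have hnear : ∀ᶠ t in 𝓝 s, t < s + ε / 6 := gt_mem_nhds (by linarith)
  refine ⟨_, (hut.and ((eventually_rate_sub_lt hs hε6).and hnear)), ?_⟩
  have hN1 : ∀ᶠ N : ℕ in atTop, 1 ≤ (N : ℝ) * (ε / 6) :=
    (tendsto_natCast_atTop_atTop.atTop_mul_const hε6).eventually_ge_atTop 1
  filter_upwards [eventually_ge_atTop 1, hN1, eventually_exp_le_hitLaw hu1 hε6] with N hN hNε h t ht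
    ht1
  obtain ⟨h1, h2, h3⟩ := ht
  have h1 := h1 ht1
  have h2 := h2 ht1
  have hle : ⌊u * N⌋₊ ≤ ⌊t * N⌋₊ := Nat.floor_mono (by gcongr)
  have h4 := hitLaw_add_ge hN ⌊u * N⌋₊ (⌊t * N⌋₊ - ⌊u * N⌋₊)
  rw [Nat.add_sub_cancel' hle] at h4
  refine le_trans ?_ h4
  refine le_trans ?_ (mul_le_mul_of_nonneg_left h (by positivity))
  rw [pow_eq_exp_mul_log (by norm_num), ← Real.exp_add, Real.exp_le_exp, Nat.cast_sub hle]
  have h5 : (⌊t * N⌋₊ : ℝ) ≤ t * N := Nat.floor_le (by positivity)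
  have h6 := Nat.lt_floor_add_one (u * N)
  have h7 : -1 ≤ Real.log (2 / 3) := by
    have := Real.one_sub_inv_le_log_of_pos (show (0 : ℝ) < 2 / 3 by norm_num)
    norm_num at this
    linarith
  have h8 : (0 : ℝ) ≤ (⌊t * N⌋₊ : ℝ) - ⌊u * N⌋₊ := sub_nonneg.2 (by exact_mod_cast hle)
  have h9 := mul_le_mul_of_nonneg_left h7 h8
  have hN0 : (0 : ℝ) ≤ N := Nat.cast_nonneg N
  have h10 := mul_le_mul_of_nonneg_left (show t - u ≤ 2 * (ε / 6) by linarith) hN0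
  have h11 := mul_le_mul_of_nonneg_left (show rate u ≤ rate t + 2 * (ε / 6) by linarith) hN0
  linarith

theorem eventually_forall_exp_le_hitLaw {K : Set ℝ} (hK : IsCompact K) (hK1 : K ⊆ Set.Ici 1)
    {ε : ℝ} (hε : 0 < ε) :
    ∀ᶠ N : ℕ in atTop, ∀ t ∈ K, Real.exp (-(N * (rate t + ε))) ≤ hitLaw N ⌊t * N⌋₊ := by
  refine hK.induction_on (p := fun T => ∀ᶠ N : ℕ in atTop, ∀ t ∈ T,
    Real.exp (-(N * (rate t + ε))) ≤ hitLaw N ⌊t * N⌋₊) ?_ ?_ ?_ ?_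
  · exact Eventually.of_forall fun N t ht => ht.elim
  · exact fun S T hST hT => hT.mono fun N h t ht => h t (hST ht)
  · intro S T hS hT
    filter_upwards [hS, hT] with N h1 h2 t ht
    exact ht.elim (h1 t) (h2 t)
  · intro s hs
    obtain ⟨U, hU, h⟩ := eventually_forall_near_exp_le_hitLaw (hK1 hs) hε
    refine ⟨U ∩ K, inter_mem (mem_nhdsWithin_of_mem_nhds hU) self_mem_nhdsWithin, h.mono fun N hN t ht => ?_⟩
    exact hN t ht.1 (hK1 ht.2)

/-- One statement serves all three probabilities. The factor 2/3 is for the event T ≥ sN, which may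
exclude the time ⌊sN⌋ but contains ⌊sN⌋ + 1. -/
theorem tendstoUniformlyOn_log_of_bounds {P : ℕ → ℝ → ℝ} {K : Set ℝ} (hK : IsCompact K)
    (hK1 : K ⊆ Set.Ici 1)
    (hlow : ∀ N : ℕ, 1 ≤ N → ∀ s ∈ K, 2 / 3 * hitLaw N ⌊s * N⌋₊ ≤ P N s)
    (hup : ∀ N : ℕ, 1 ≤ N → ∀ s ∈ K, P N s ≤ 8 * Real.exp (-(N * rate s))) :
    TendstoUniformlyOn (fun (N : ℕ) s => 1 / (N : ℝ) * Real.log (P N s))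
      (fun s => -Psi s) atTop K := by
  rw [Metric.tendstoUniformlyOn_iff]
  intro ε hε
  have hN1 : ∀ᶠ N : ℕ in atTop, Real.log 8 + 1 ≤ (N : ℝ) * (ε / 2) :=
    (tendsto_natCast_atTop_atTop.atTop_mul_const (half_pos hε)).eventually_ge_atTop _
  filter_upwards [eventually_ge_atTop 1, hN1,
    eventually_forall_exp_le_hitLaw hK hK1 (half_pos hε)] with N hN hNε h s hs
  have hN0 : (0 : ℝ) < N := by exact_mod_cast hN
  have hl := hlow N hN s hs
  have hu := hup N hN s hs
  have he := h s hs
  have h0 : 0 < hitLaw N ⌊s * N⌋₊ := (Real.exp_pos _).trans_le he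
  have hP : 0 < P N s := lt_of_lt_of_le (by positivity) hl
  have hu' := Real.log_le_log hP hu
  rw [Real.log_mul (by norm_num) (Real.exp_pos _).ne', Real.log_exp] at hu'
  have hl' := Real.log_le_log (by positivity)
    ((mul_le_mul_of_nonneg_left he (by norm_num : (0 : ℝ) ≤ 2 / 3)).trans hl)
  rw [Real.log_mul (by norm_num) (Real.exp_pos _).ne', Real.log_exp] at hl'
  have h7 : -1 < Real.log (2 / 3) := by
    have := Real.one_sub_inv_le_log_of_pos (show (0 : ℝ) < 2 / 3 by norm_num)
    norm_num at this
    linarith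
  have h8 : 0 ≤ Real.log 8 := Real.log_nonneg (by norm_num)
  rw [Psi_eq_rate (hK1 hs), Real.dist_eq, abs_sub_comm, abs_lt, one_div, inv_mul_eq_div]
  constructor
  · rw [lt_sub_iff_add_lt, lt_div_iff₀ hN0]
    linarith
  · rw [sub_lt_iff_lt_add, div_lt_iff₀ hN0]
    have : 0 < N * ε := by positivity
    linarith

/-! ### The hitting probabilities -/

theorem ENat.toENNReal_le_ofReal_iff {n : ℕ∞} {x : ℝ} (hx : 0 ≤ x) :
    (n : ℝ≥0∞) ≤ ENNReal.ofReal x ↔ n ≤ (⌊x⌋₊ : ℕ∞) := by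
  cases n with
  | top => simp
  | coe n =>
    rw [ENat.toENNReal_coe, Nat.cast_le, Nat.le_floor_iff hx, ← ENNReal.ofReal_natCast,
      ENNReal.ofReal_le_ofReal_iff hx]

theorem ENat.ofReal_le_toENNReal_natCast_iff {n : ℕ} {x : ℝ} :
    ENNReal.ofReal x ≤ ((n : ℕ∞) : ℝ≥0∞) ↔ x ≤ n := by
  rw [ENat.toENNReal_coe, ← ENNReal.ofReal_natCast, ENNReal.ofReal_le_ofReal_iff n.cast_nonneg]

theorem probHitLE_eq {Ω : Type*} [MeasurableSpace Ω] {μ : Measure Ω} {Z : ℕ → Ω → ℕ} {N : ℕ} {s : ℝ}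
    (hs : 0 ≤ s) :
    probHitLE μ Z N s = μ.real {ω | firstHit Z N ω ≤ (⌊s * N⌋₊ : ℕ∞)} := by
  unfold probHitLE
  congr 1
  ext ω
  exact ENat.toENNReal_le_ofReal_iff (by positivity)

section

variable {Ω : Type*} [MeasurableSpace Ω] {μ : Measure Ω} [IsProbabilityMeasure μ]
  {Z : ℕ → Ω → ℕ}

theorem probHitEq_eq (hZ : IsMarkovChainFrom μ walkStep 0 Z) {N : ℕ} (hN : 1 ≤ N) (s : ℝ) :
    probHitEq μ Z N s = hitLaw N ⌊s * N⌋₊ :=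
  real_firstHit_eq hZ hN _

theorem hitLaw_le_probHitLE (hZ : IsMarkovChainFrom μ walkStep 0 Z) {N : ℕ} (hN : 1 ≤ N) {s : ℝ}
    (hs : 0 ≤ s) : hitLaw N ⌊s * N⌋₊ ≤ probHitLE μ Z N s := by
  rw [probHitLE_eq hs, ← real_firstHit_eq hZ hN]
  exact measureReal_mono fun ω hω => le_of_eq hω

theorem hitLaw_le_probHitGE (hZ : IsMarkovChainFrom μ walkStep 0 Z) {N : ℕ} (hN : 1 ≤ N) (s : ℝ) :
    hitLaw N (⌊s * N⌋₊ + 1) ≤ probHitGE μ Z N s := by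
  rw [probHitGE, ← real_firstHit_eq hZ hN]
  refine measureReal_mono fun ω hω => ?_
  have hω' : firstHit Z N ω = ((⌊s * N⌋₊ + 1 : ℕ) : ℕ∞) := hω
  change ENNReal.ofReal (s * N) ≤ (firstHit Z N ω : ℝ≥0∞)
  rw [hω', ENat.ofReal_le_toENNReal_natCast_iff]
  push_cast
  exact (Nat.lt_floor_add_one _).le

theorem probHitLE_le (hZ : IsMarkovChainFrom μ walkStep 0 Z) {N : ℕ} (hN : 1 ≤ N) {s : ℝ}
    (hs : 1 ≤ s) (hs6 : s ≤ 6) : probHitLE μ Z N s ≤ 8 * Real.exp (-(N * rate s)) := by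
  rw [probHitLE_eq (by linarith)]
  refine ((real_firstHit_le hZ hN _).trans (sum_hitLaw_le_rate hN hs hs6)).trans ?_
  linarith [Real.exp_pos (-(N * rate s))]

theorem real_le_firstHit_le (hZ : IsMarkovChainFrom μ walkStep 0 Z) {N : ℕ} (hN : 1 ≤ N) {s : ℝ}
    (hs : 6 ≤ s) :
    μ.real {ω | (⌊s * N⌋₊ : ℕ∞) ≤ firstHit Z N ω} ≤ 8 * Real.exp (-(N * rate s)) := by
  refine le_trans ?_ (sum_killedLaw_le hN hs)
  rw [← real_lt_firstHit hZ hN]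
  have hN' : (1 : ℝ) ≤ N := by exact_mod_cast hN
  have h1 : 1 ≤ ⌊s * N⌋₊ := Nat.le_floor (by push_cast; nlinarith)
  have h2 : ((⌊s * N⌋₊ - 1 : ℕ) : ℕ∞) < ⌊s * N⌋₊ := by
    exact_mod_cast (by omega : ⌊s * N⌋₊ - 1 < ⌊s * N⌋₊)
  exact measureReal_mono fun ω hω => LT.lt.trans_le h2 hω

theorem probHitGE_le (hZ : IsMarkovChainFrom μ walkStep 0 Z) {N : ℕ} (hN : 1 ≤ N) {s : ℝ}
    (hs : 6 ≤ s) : probHitGE μ Z N s ≤ 8 * Real.exp (-(N * rate s)) := by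
  refine le_trans (measureReal_mono fun ω hω => ?_) (real_le_firstHit_le hZ hN hs)
  have hω' : ENNReal.ofReal (s * N) ≤ (firstHit Z N ω : ℝ≥0∞) := hω
  change (⌊s * N⌋₊ : ℕ∞) ≤ firstHit Z N ω
  rw [← ENat.toENNReal_le]
  refine le_trans ?_ hω'
  rw [ENat.toENNReal_coe, ← ENNReal.ofReal_natCast]
  exact ENNReal.ofReal_le_ofReal (Nat.floor_le (by positivity))

theorem tendstoUniformlyOn_probHitEq_probHitLE (hZ : IsMarkovChainFrom μ walkStep 0 Z)
    {K : Set ℝ} (hK : IsCompact K) (hK16 : K ⊆ Set.Icc 1 6) :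
    TendstoUniformlyOn (fun (N : ℕ) s => 1 / (N : ℝ) * Real.log (probHitEq μ Z N s))
        (fun s => -Psi s) atTop K ∧
      TendstoUniformlyOn (fun (N : ℕ) s => 1 / (N : ℝ) * Real.log (probHitLE μ Z N s))
        (fun s => -Psi s) atTop K := by
  have h1 : K ⊆ Set.Ici 1 := fun s hs => (hK16 hs).1
  constructor
  · refine tendstoUniformlyOn_log_of_bounds hK h1 (fun N hN s hs => ?_) fun N hN s hs => ?_
    · rw [probHitEq_eq hZ hN]
      linarith [hitLaw_nonneg N ⌊s * N⌋₊]
    · rw [probHitEq_eq hZ hN]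
      exact (hitLaw_le_probHitLE hZ hN (by linarith [(hK16 hs).1])).trans
        (probHitLE_le hZ hN (hK16 hs).1 (hK16 hs).2)
  · refine tendstoUniformlyOn_log_of_bounds hK h1 (fun N hN s hs => ?_) fun N hN s hs => ?_
    · have := hitLaw_le_probHitLE hZ hN (s := s) (by linarith [(hK16 hs).1])
      linarith [hitLaw_nonneg N ⌊s * N⌋₊]
    · exact probHitLE_le hZ hN (hK16 hs).1 (hK16 hs).2

theorem tendstoUniformlyOn_probHitEq_probHitGE (hZ : IsMarkovChainFrom μ walkStep 0 Z)
    {K : Set ℝ} (hK : IsCompact K) (hK6 : K ⊆ Set.Ici 6) :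
    TendstoUniformlyOn (fun (N : ℕ) s => 1 / (N : ℝ) * Real.log (probHitEq μ Z N s))
        (fun s => -Psi s) atTop K ∧
      TendstoUniformlyOn (fun (N : ℕ) s => 1 / (N : ℝ) * Real.log (probHitGE μ Z N s))
        (fun s => -Psi s) atTop K := by
  have h1 : K ⊆ Set.Ici 1 := fun s hs => le_trans (by norm_num) (Set.mem_Ici.1 (hK6 hs))
  constructor
  · refine tendstoUniformlyOn_log_of_bounds hK h1 (fun N hN s hs => ?_) fun N hN s hs => ?_
    · rw [probHitEq_eq hZ hN]
      linarith [hitLaw_nonneg N ⌊s * N⌋₊]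
    -- The bound goes through T ≥ ⌊sN⌋, since T = ⌊sN⌋ need not imply T ≥ sN.
    · exact (measureReal_mono fun ω hω => ge_of_eq hω).trans (real_le_firstHit_le hZ hN (hK6 hs))
  · refine tendstoUniformlyOn_log_of_bounds hK h1 (fun N hN s hs => ?_) fun N hN s hs => ?_
    · exact (hitLaw_succ_ge hN _).trans (hitLaw_le_probHitGE hZ hN s)
    · exact probHitGE_le hZ hN (hK6 hs)

end

theorem mainTheorem9 {Ω : Type*} [MeasurableSpace Ω] (μ : Measure Ω) [IsProbabilityMeasure μ]
    (Z : ℕ → Ω → ℕ) (hZ : IsMarkovChainFrom μ walkStep 0 Z) :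
    -- the rate function is finite on `[1, ∞)`, so that `Psi` is the Legendre transform there
    (∀ s : ℝ, 1 ≤ s → ((Psi s : ℝ) : EReal) = PsiExt s) ∧
    -- the logarithms below are logarithms of positive numbers
    (∀ N : ℕ, 1 ≤ N → ∀ s : ℝ, 1 ≤ s →
      0 < probHitEq μ Z N s ∧ 0 < probHitLE μ Z N s ∧ 0 < probHitGE μ Z N s) ∧
    -- large deviations below the mean
    (∀ s ∈ Set.Icc (1 : ℝ) 6,
      Tendsto (fun N : ℕ => 1 / (N : ℝ) * Real.log (probHitEq μ Z N s)) atTop (𝓝 (-Psi s)) ∧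
      Tendsto (fun N : ℕ => 1 / (N : ℝ) * Real.log (probHitLE μ Z N s)) atTop (𝓝 (-Psi s))) ∧
    -- large deviations above the mean
    (∀ s ∈ Set.Ici (6 : ℝ),
      Tendsto (fun N : ℕ => 1 / (N : ℝ) * Real.log (probHitEq μ Z N s)) atTop (𝓝 (-Psi s)) ∧
      Tendsto (fun N : ℕ => 1 / (N : ℝ) * Real.log (probHitGE μ Z N s)) atTop (𝓝 (-Psi s))) ∧
    -- the convergence is uniform on compact sets
    (∀ K : Set ℝ, IsCompact K → K ⊆ Set.Icc 1 6 →
      TendstoUniformlyOn (fun (N : ℕ) s => 1 / (N : ℝ) * Real.log (probHitEq μ Z N s))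
        (fun s => -Psi s) atTop K ∧
      TendstoUniformlyOn (fun (N : ℕ) s => 1 / (N : ℝ) * Real.log (probHitLE μ Z N s))
        (fun s => -Psi s) atTop K) ∧
    (∀ K : Set ℝ, IsCompact K → K ⊆ Set.Ici 6 →
      TendstoUniformlyOn (fun (N : ℕ) s => 1 / (N : ℝ) * Real.log (probHitEq μ Z N s))
        (fun s => -Psi s) atTop K ∧
      TendstoUniformlyOn (fun (N : ℕ) s => 1 / (N : ℝ) * Real.log (probHitGE μ Z N s))
        (fun s => -Psi s) atTop K) ∧
    -- behaviour of the rate function at the mean: value, first and second derivative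
    Psi 6 = 0 ∧ HasDerivAt Psi 0 6 ∧
    (∀ᶠ s in 𝓝 (6 : ℝ), DifferentiableAt ℝ Psi s) ∧
    (∃ c : ℝ, 0 < c ∧ HasDerivAt (deriv Psi) c 6) := by
  refine ⟨fun s hs => ?_, fun N hN s hs => ?_, fun s hs => ?_, fun s hs => ?_,
    fun K hK hK16 => tendstoUniformlyOn_probHitEq_probHitLE hZ hK hK16,
    fun K hK hK6 => tendstoUniformlyOn_probHitEq_probHitGE hZ hK hK6, Psi_six, ?_, ?_,
    exists_hasDerivAt_deriv_Psi⟩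
  · rw [Psi_eq_rate hs, PsiExt_eq_rate hs]
  · have hNs : N ≤ ⌊s * N⌋₊ := Nat.le_floor (le_mul_of_one_le_left N.cast_nonneg hs)
    rw [probHitEq_eq hZ hN]
    exact ⟨hitLaw_pos hN hNs,
      (hitLaw_pos hN hNs).trans_le (hitLaw_le_probHitLE hZ hN (by linarith)),
      (hitLaw_pos hN (by omega)).trans_le (hitLaw_le_probHitGE hZ hN s)⟩
  · obtain ⟨h1, h2⟩ := tendstoUniformlyOn_probHitEq_probHitLE hZ isCompact_singleton
      (Set.singleton_subset_iff.2 hs)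
    exact ⟨h1.tendsto_at rfl, h2.tendsto_at rfl⟩
  · obtain ⟨h1, h2⟩ := tendstoUniformlyOn_probHitEq_probHitGE hZ isCompact_singleton
      (Set.singleton_subset_iff.2 hs)
    exact ⟨h1.tendsto_at rfl, h2.tendsto_at rfl⟩
  · have h := hasDerivAt_Psi (s := 6) (by norm_num)
    rwa [tiltRoot_six, tiltRate_one, Real.log_one] at h
  · filter_upwards [lt_mem_nhds (show (1 : ℝ) < 6 by norm_num)] with s hs
    exact (hasDerivAt_Psi hs).differentiableAt
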